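/- **Proposition 5.4.** *Conventions.* A meromorphic function on $\mathbb{C}^n$ is an element of the quotient field of the ring of entire functions on $\mathbb{C}^n$. The group of periods of a meromorphic map $f=(f_1,\dots,f_n)$ on $\mathbb{C}^n$ is $\Lambda_f=\{a\in\mathbb{C}^n : f(u+a)=f(u)\}$. A discrete subgroup $\Lambda$ of a finite-dimensional complex vector space is a free $\mathbb{Z}$-module of finite rank, denoted $\operatorname{rank}\Lambda$; a discrete subgroup of $(\mathbb{C}^n,+)$ is a lattice if its rank is $2n$. Let $\mathbb{L}$ be a field of meromorphic functions on $\mathbb{C}^n$, containing $\mathbb{C}$ and of transcendence degree $n$ over $\mathbb{C}$. We write $\mathbb{Z}\text{-}\operatorname{rank}\mathbb{L}=m$ if $\mathbb{L}$ has a transcendence basis $f=(f_1,\dots,f_n)$ over $\mathbb{C}$ for which $\Lambda_f$ is discrete, and $\operatorname{rank}\Lambda_f=m$ for every such $f$. For a family $\mathcal{P}$ of fields of meromorphic functions on $\mathbb{C}^n$ we write $\mathbb{Z}\text{-}\operatorname{rank}\mathcal{P}=m$ if every $\mathbb{L}\in\mathcal{P}$ has transcendence degree $n$ over $\mathbb{C}$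 and $\mathbb{Z}\text{-}\operatorname{rank}\mathbb{L}=m$. For a lattice $\Omega$ of $(\mathbb{C},+)$ let $$\sigma_\Omega(u)=u\prod_{\omega\in\Omega\setminus\{0\}}\Bigl(1-\frac u\omega\Bigr)\exp\Bigl(\frac u\omega+\frac12\Bigl(\frac u\omega\Bigr)^2\Bigr),\qquad \zeta_\Omega=\frac{\sigma_\Omega'}{\sigma_\Omega},\qquad \wp_\Omega=-\zeta_\Omega',$$ and for a lattice $\Lambda$ of $(\mathbb{C}^2,+)$ let $\mathbb{C}(\Lambda)$ be the field of the meromorphic functions on $\mathbb{C}^2$ all of whose translates by elements of $\Lambda$ equal the function itself. Painlevé's families are $$\mathcal{P}_1=\{\mathbb{C}(g_1\circ\alpha)\},\qquad g_1(u,v)=(u,v);$$ $$\mathcal{P}_2=\{\mathbb{C}(g_2\circ\alpha)\},\qquad g_2(u,v)=(e^u,v);$$ $$\mathcal{P}_3=\{\mathbb{C}(g_3\circ\alpha)\},\qquad g_3(u,v)=(e^u,e^v);$$ $$\mathcal{P}_4=\{\mathbb{C}(g_{4,a,\Omega}\circ\alpha) : a\in\{0,1\}\},\qquad g_{4,a,\Omega}(u,v)=(\wp_\Omega(u),\,v-a\,\zeta_\Omega(u));$$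 $$\mathcal{P}_5=\{\mathbb{C}(g_{5,a,\Omega}\circ\alpha) : a\in\mathbb{C}\},\qquad g_{5,a,\Omega}(u,v)=\Bigl(\wp_\Omega(u),\,\frac{\sigma_\Omega(u-a)}{\sigma_\Omega(u)}\,e^v\Bigr);$$ $$\mathcal{P}_6=\{\mathbb{C}(\Lambda) : \Lambda\text{ a lattice of }(\mathbb{C}^2,+),\ \operatorname{tr.deg.}_{\mathbb{C}}\mathbb{C}(\Lambda)=2\},$$ where $\alpha$ ranges over $GL_2(\mathbb{C})$, $\Omega$ ranges over the lattices of $(\mathbb{C},+)$, and $\mathbb{C}(g)$ is the field generated over $\mathbb{C}$ by the two coordinates of $g$. *Claim.* $$\mathbb{Z}\text{-}\operatorname{rank}\mathcal{P}_1=0,\quad \mathbb{Z}\text{-}\operatorname{rank}\mathcal{P}_2=1,\quad \mathbb{Z}\text{-}\operatorname{rank}\mathcal{P}_3=2,\quad \mathbb{Z}\text{-}\operatorname{rank}\mathcal{P}_4=2,\quad \mathbb{Z}\text{-}\operatorname{rank}\mathcal{P}_5=3,\quad \mathbb{Z}\text{-}\operatorname{rank}\mathcal{P}_6=4.$$ 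-/

import Mathlib

open Set Filter Topology

noncomputable section

namespace Painleve

/-! ## Meromorphic functions on `ℂⁿ` -/

/-- The algebra of entire functions `ℂⁿ → ℂ`, i.e. functions that are analytic on all of `ℂⁿ`. -/
def entireSubalgebra (n : ℕ) : Subalgebra ℂ ((Fin n → ℂ) → ℂ) where
  carrier := {f | AnalyticOnNhd ℂ f univ}
  mul_mem' hf hg := AnalyticOnNhd.mul hf hg
  add_mem' hf hg := AnalyticOnNhd.add hf hg
  algebraMap_mem' _ := analyticOnNhd_const

/-- The ring of entire functions on `ℂⁿ`. -/
def Entire (n : ℕ) : Type := entireSubalgebra n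

instance (n : ℕ) : CommRing (Entire n) := inferInstanceAs (CommRing (entireSubalgebra n))

instance (n : ℕ) : Algebra ℂ (Entire n) := inferInstanceAs (Algebra ℂ (entireSubalgebra n))

instance (n : ℕ) : Nontrivial (Entire n) := inferInstanceAs (Nontrivial (entireSubalgebra n))

instance (n : ℕ) : FunLike (Entire n) (Fin n → ℂ) ℂ := ⟨Subtype.val, Subtype.val_injective⟩

/-- An analytic function, as an element of the ring of entire functions. -/
def Entire.mk {n : ℕ} (f : (Fin n → ℂ) → ℂ) (hf : AnalyticOnNhd ℂ f univ) : Entire n := ⟨f, hf⟩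

theorem Entire.analytic {n : ℕ} (f : Entire n) : AnalyticOnNhd ℂ f univ := f.2

section

variable {n : ℕ} (f g : Entire n) (c : ℂ) (z : Fin n → ℂ)

@[simp] theorem Entire.mk_apply (F : (Fin n → ℂ) → ℂ) (hF : AnalyticOnNhd ℂ F univ) :
    Entire.mk F hF z = F z := rfl

@[simp] theorem Entire.mul_apply : (f * g) z = f z * g z := rfl

@[simp] theorem Entire.add_apply : (f + g) z = f z + g z := rfl

@[simp] theorem Entire.sub_apply : (f - g) z = f z - g z := rfl

@[simp] theorem Entire.pow_apply (k : ℕ) : (f ^ k) z = f z ^ k := rfl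

@[simp] theorem Entire.smul_apply : (c • f) z = c * f z := rfl

@[simp] theorem Entire.zero_apply : (0 : Entire n) z = 0 := rfl

@[simp] theorem Entire.one_apply : (1 : Entire n) z = 1 := rfl

end

/-- The identity principle: an entire function that vanishes off the zeros of a nonzero entire
function is zero. -/
theorem Entire.eq_zero_of_mul {n : ℕ} {f g : Entire n} (hf : f ≠ 0)
    (h : ∀ z, f z ≠ 0 → g z = 0) : g = 0 := by
  obtain ⟨x, hx⟩ : ∃ x, f x ≠ 0 := by
    by_contra! H
    exact hf (DFunLike.ext _ _ fun z => by simpa using H z)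
  have hc : ContinuousAt f x := (f.analytic x (mem_univ x)).continuousAt
  have hev : (g : (Fin n → ℂ) → ℂ) =ᶠ[𝓝 x] fun _ => 0 := by
    filter_upwards [hc.eventually_ne hx] with z hz using h z hz
  have := AnalyticOnNhd.eq_of_eventuallyEq g.analytic
    (analyticOnNhd_const (v := (0 : ℂ))) hev
  exact DFunLike.ext _ _ fun z => congrFun this z

instance (n : ℕ) : IsDomain (Entire n) := by
  have : NoZeroDivisors (Entire n) := ⟨by
    intro f g hfg
    by_cases hf : f = 0
    · exact Or.inl hf
    · refine Or.inr (Entire.eq_zero_of_mul hf fun z hz => ?_)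
      have : f z * g z = 0 := DFunLike.congr_fun hfg z
      exact (mul_eq_zero.mp this).resolve_left hz⟩
  exact NoZeroDivisors.to_isDomain _

/-- The field of meromorphic functions on `ℂⁿ`: the quotient field of the ring of entire
functions on `ℂⁿ`. -/
def Mero (n : ℕ) : Type := FractionRing (Entire n)

instance (n : ℕ) : Field (Mero n) := inferInstanceAs (Field (FractionRing (Entire n)))

instance (n : ℕ) : Algebra (Entire n) (Mero n) :=
  inferInstanceAs (Algebra (Entire n) (FractionRing (Entire n)))

instance (n : ℕ) : IsFractionRing (Entire n) (Mero n) :=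
  inferInstanceAs (IsFractionRing (Entire n) (FractionRing (Entire n)))

instance (n : ℕ) : Algebra ℂ (Mero n) := inferInstanceAs (Algebra ℂ (FractionRing (Entire n)))

instance (n : ℕ) : IsScalarTower ℂ (Entire n) (Mero n) :=
  inferInstanceAs (IsScalarTower ℂ (Entire n) (FractionRing (Entire n)))

/-- The entire function `h`, viewed as a meromorphic function. -/
abbrev Entire.toMero {n : ℕ} (h : Entire n) : Mero n := algebraMap (Entire n) (Mero n) h

theorem Entire.toMero_ne_zero {n : ℕ} {h : Entire n} (hh : h ≠ 0) : h.toMero ≠ 0 := by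
  simpa [Entire.toMero] using hh

/-- The function `F : ℂⁿ → ℂ` agrees with the quotient `g / h` of two entire functions wherever
`h` does not vanish. The values of `F` at the zeros of `h` are irrelevant. -/
def IsQuotient {n : ℕ} (F : (Fin n → ℂ) → ℂ) (g h : Entire n) : Prop :=
  h ≠ 0 ∧ ∀ z, h z ≠ 0 →
    F z = g z / h z

/-- `F` is (the restriction to a dense open set of) a meromorphic function on `ℂⁿ`. -/
def IsMero {n : ℕ} (F : (Fin n → ℂ) → ℂ) : Prop := ∃ g h : Entire n, IsQuotient F g h

/-- The element `g / h` of the field of meromorphic functions that is given by a function `F`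
with `F = g / h` off the zeros of `h`. It does not depend on the choice of `g` and `h`. -/
def ofFun {n : ℕ} (F : (Fin n → ℂ) → ℂ) (hF : IsMero F) : Mero n :=
  hF.choose.toMero / hF.choose_spec.choose.toMero

theorem ofFun_eq {n : ℕ} {F : (Fin n → ℂ) → ℂ} (hF : IsMero F) {g h : Entire n}
    (H : IsQuotient F g h) : ofFun F hF = g.toMero / h.toMero := by
  have H' := hF.choose_spec.choose_spec
  unfold ofFun
  set g' := hF.choose
  set h' := hF.choose_spec.choose
  rw [div_eq_div_iff (Entire.toMero_ne_zero H'.1) (Entire.toMero_ne_zero H.1), ← map_mul,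
    ← map_mul]
  congr 1
  rw [← sub_eq_zero]
  refine Entire.eq_zero_of_mul (mul_ne_zero H.1 H'.1) fun z hz => ?_
  have hz' : h z ≠ 0 ∧ h' z ≠ 0 := by
    simpa using hz
  have e := (H.2 z hz'.1).symm.trans (H'.2 z hz'.2)
  rw [div_eq_div_iff hz'.1 hz'.2] at e
  have : g' z * h z
      - g z * h' z = 0 := by rw [e]; ring
  simpa using this

/-! ## Change of variables -/

/-- Change of variables `h ↦ h ∘ φ` for entire functions. -/
def Entire.comp {n : ℕ} (φ : (Fin n → ℂ) → (Fin n → ℂ)) (hφ : AnalyticOnNhd ℂ φ univ) :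
    Entire n →ₐ[ℂ] Entire n where
  toFun h := Entire.mk (fun z => h (φ z))
    (AnalyticOnNhd.comp (g := h) h.analytic hφ (mapsTo_univ _ _))
  map_one' := rfl
  map_mul' _ _ := rfl
  map_zero' := rfl
  map_add' _ _ := rfl
  commutes' _ := rfl

theorem Entire.comp_injective {n : ℕ} {φ : (Fin n → ℂ) → (Fin n → ℂ)}
    (hφ : AnalyticOnNhd ℂ φ univ) (hs : Function.Surjective φ) :
    Function.Injective (Entire.comp φ hφ) := by
  intro f g hfg
  refine DFunLike.ext _ _ fun z => ?_
  obtain ⟨w, rfl⟩ := hs z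
  exact DFunLike.congr_fun hfg w

@[simp] theorem Entire.comp_apply {n : ℕ} (φ : (Fin n → ℂ) → (Fin n → ℂ))
    (hφ : AnalyticOnNhd ℂ φ univ) (h : Entire n) (z : Fin n → ℂ) :
    Entire.comp φ hφ h z = h (φ z) := rfl

/-- Change of variables `g / h ↦ (g ∘ φ) / (h ∘ φ)` for meromorphic functions, along a surjective
analytic map `φ : ℂⁿ → ℂⁿ`. -/
def Mero.comp {n : ℕ} (φ : (Fin n → ℂ) → (Fin n → ℂ)) (hφ : AnalyticOnNhd ℂ φ univ)
    (hs : Function.Surjective φ) : Mero n →ₐ[ℂ] Mero n :=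
  IsFractionRing.liftAlgHom (A := Entire n) (K := Mero n)
    (g := (Algebra.ofId (Entire n) (Mero n)).restrictScalars ℂ |>.comp (Entire.comp φ hφ))
    ((IsFractionRing.injective (Entire n) (Mero n)).comp (Entire.comp_injective hφ hs))

theorem Mero.comp_div {n : ℕ} (φ : (Fin n → ℂ) → (Fin n → ℂ)) (hφ : AnalyticOnNhd ℂ φ univ)
    (hs : Function.Surjective φ) (g h : Entire n) :
    Mero.comp φ hφ hs (g.toMero / h.toMero) =
      (Entire.comp φ hφ g).toMero / (Entire.comp φ hφ h).toMero := by
  have key : ∀ k : Entire n, Mero.comp φ hφ hs k.toMero = (Entire.comp φ hφ k).toMero := fun k =>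
    IsFractionRing.lift_algebraMap (A := Entire n) (K := Mero n)
      (g := ((Algebra.ofId (Entire n) (Mero n)).restrictScalars ℂ |>.comp
        (Entire.comp φ hφ)).toRingHom)
      ((IsFractionRing.injective (Entire n) (Mero n)).comp (Entire.comp_injective hφ hs)) k
  rw [map_div₀, key, key]

/-- The meromorphic function `u ↦ f (u + a)`. -/
def Mero.translate {n : ℕ} (a : Fin n → ℂ) : Mero n →ₐ[ℂ] Mero n :=
  Mero.comp (fun z => z + a) (analyticOnNhd_id.add analyticOnNhd_const)
    (fun z => ⟨z - a, sub_add_cancel z a⟩)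

/-- The meromorphic function `f ∘ α` for an invertible matrix `α`. -/
def Mero.compGL {n : ℕ} (α : GL (Fin n) ℂ) : Mero n →ₐ[ℂ] Mero n :=
  Mero.comp (fun z => α.1.mulVec z)
    (fun z _ => (Matrix.mulVecLin α.1).toContinuousLinearMap.analyticAt z)
    (fun z => ⟨(α⁻¹).1.mulVec z, by
      simp only [Matrix.mulVec_mulVec, ← Units.val_mul, mul_inv_cancel, Units.val_one,
        Matrix.one_mulVec]⟩)

theorem Mero.translate_zero {n : ℕ} (f : Mero n) : Mero.translate 0 f = f := by
  obtain ⟨g, h, -, rfl⟩ := IsFractionRing.div_surjective (Entire n) f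
  refine (Mero.comp_div _ _ _ g h).trans ?_
  congr 2 <;> exact DFunLike.ext _ _ fun z => by simp

theorem Mero.translate_translate {n : ℕ} (a b : Fin n → ℂ) (f : Mero n) :
    Mero.translate a (Mero.translate b f) = Mero.translate (a + b) f := by
  obtain ⟨g, h, -, rfl⟩ := IsFractionRing.div_surjective (Entire n) f
  refine (congrArg (Mero.translate a) (Mero.comp_div _ _ _ g h)).trans ?_
  refine (Mero.comp_div _ _ _ _ _).trans (Eq.trans ?_ (Mero.comp_div _ _ _ g h).symm)
  congr 2 <;> exact DFunLike.ext _ _ fun z => by simp [add_assoc]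

/-! ## Periods, lattices and the `ℤ`-rank -/

/-- The group of periods `{a | f (u + a) = f u}` of a meromorphic map `f = (f_i)_i` on `ℂⁿ`. -/
def periods {n : ℕ} {ι : Type*} (f : ι → Mero n) : AddSubgroup (Fin n → ℂ) where
  carrier := {a | ∀ i, Mero.translate a (f i) = f i}
  zero_mem' i := Mero.translate_zero (f i)
  add_mem' {a b} ha hb i := by
    rw [← Mero.translate_translate, hb i, ha i]
  neg_mem' {a} ha i := by
    conv_lhs => rw [← ha i]
    rw [Mero.translate_translate, neg_add_cancel, Mero.translate_zero]

/-- The periods in terms of a presentation `f = g / h` of the meromorphic map `f`. -/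
theorem mem_periods_div_iff {n : ℕ} {ι : Type*} (g h : ι → Entire n) (hh : ∀ i, h i ≠ 0)
    (a : Fin n → ℂ) :
    a ∈ periods (fun i => (g i).toMero / (h i).toMero) ↔
      ∀ i, ∀ b : Fin n → ℂ, (g i) b * (h i) (b + a) =
        (h i) b * (g i) (b + a) := by
  refine forall_congr' fun i => ?_
  have hs : Function.Surjective fun z : Fin n → ℂ => z + a := fun z => ⟨z - a, sub_add_cancel z a⟩
  have hφ : AnalyticOnNhd ℂ (fun z : Fin n → ℂ => z + a) univ :=
    analyticOnNhd_id.add analyticOnNhd_const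
  have h0 : Entire.comp _ hφ (h i) ≠ 0 := by
    rw [Ne, map_eq_zero_iff _ (Entire.comp_injective hφ hs)]
    exact hh i
  have e : Mero.translate a ((g i).toMero / (h i).toMero) =
      (Entire.comp _ hφ (g i)).toMero / (Entire.comp _ hφ (h i)).toMero := Mero.comp_div _ _ _ _ _
  rw [e, div_eq_div_iff (Entire.toMero_ne_zero h0) (Entire.toMero_ne_zero (hh i)), ← map_mul,
    ← map_mul, (IsFractionRing.injective (Entire n) (Mero n)).eq_iff]
  constructor
  · intro H b
    have := DFunLike.congr_fun H b
    simp only [Entire.mul_apply, Entire.comp_apply] at this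
    linear_combination -this
  · intro H
    refine DFunLike.ext _ _ fun b => ?_
    have := H b
    simp only [Entire.mul_apply, Entire.comp_apply]
    linear_combination -this

/-- A lattice of a finite-dimensional real vector space `E` (here `ℂ` or `ℂⁿ`): a discrete
subgroup whose rank as a (free) `ℤ`-module is the real dimension of `E`, i.e. `2` for `ℂ` and
`2 n` for `ℂⁿ`. -/
def IsLattice {E : Type*} [NormedAddCommGroup E] [NormedSpace ℝ E] (Λ : AddSubgroup E) : Prop :=
  DiscreteTopology Λ ∧ Module.finrank ℤ Λ = Module.finrank ℝ E

/-- `ℤ-rank L = m`, for a field `L` of meromorphic functions on `ℂⁿ`: the transcendence degree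
of `L` over `ℂ` is `n`, there is a transcendence basis `f = (f_1, …, f_n)` of `L` over `ℂ` with a
discrete group of periods, and the group of periods of any such basis has rank `m`. -/
def HasZRank {n : ℕ} (L : IntermediateField ℂ (Mero n)) (m : ℕ) : Prop :=
  Algebra.trdeg ℂ L = n ∧
  (∃ f : Fin n → L, IsTranscendenceBasis ℂ f ∧
    DiscreteTopology (periods fun i => (f i : Mero n))) ∧
  ∀ f : Fin n → L, IsTranscendenceBasis ℂ f →
    DiscreteTopology (periods fun i => (f i : Mero n)) →
    Module.finrank ℤ (periods fun i => (f i : Mero n)) = m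

/-- `ℤ-rank P = m`, for a family `P` of fields of meromorphic functions on `ℂⁿ`. -/
def FamilyHasZRank {n : ℕ} (P : Set (IntermediateField ℂ (Mero n))) (m : ℕ) : Prop :=
  ∀ L ∈ P, HasZRank L m

/-- The field `ℂ(g)` generated over `ℂ` by the coordinates of a meromorphic map `g`. -/
def fieldOf {n : ℕ} {ι : Type*} (g : ι → Mero n) : IntermediateField ℂ (Mero n) :=
  IntermediateField.adjoin ℂ (range g)

/-- The field `ℂ(Λ)` of the meromorphic functions on `ℂⁿ` whose group of periods contains `Λ`
(the abelian functions corresponding to `Λ`, when `Λ` is a lattice). -/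
def abelianFunctions {n : ℕ} (Λ : AddSubgroup (Fin n → ℂ)) : IntermediateField ℂ (Mero n) where
  carrier := {f | Λ ≤ periods fun _ : Unit => f}
  mul_mem' hf hg a ha i := by rw [map_mul, hf ha i, hg ha i]
  add_mem' hf hg a ha i := by rw [map_add, hf ha i, hg ha i]
  algebraMap_mem' c a _ _ := AlgHom.commutes _ c
  inv_mem' f hf a ha i := by rw [map_inv₀, hf ha i]

/-! ## The Weierstrass functions -/

/-- The factor `(1 - u/ω) exp (u/ω + (u/ω)²/2)` of the product that defines `σ`. -/
def sigmaFactor (ω u : ℂ) : ℂ := (1 - u / ω) * Complex.exp (u / ω + (1 / 2) * (u / ω) ^ 2)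

/-- The Weierstrass `σ`-function of a lattice `Ω` of `ℂ`. -/
def sigma (Ω : AddSubgroup ℂ) (u : ℂ) : ℂ := u * ∏' ω : {ω : Ω // ω ≠ 0}, sigmaFactor (ω.1 : ℂ) u

/-- The Weierstrass `ζ`-function `σ' / σ` of a lattice `Ω` of `ℂ`. -/
def zeta (Ω : AddSubgroup ℂ) (u : ℂ) : ℂ := deriv (sigma Ω) u / sigma Ω u

/-- The Weierstrass `℘`-function `-ζ'` of a lattice `Ω` of `ℂ`. -/
def wp (Ω : AddSubgroup ℂ) (u : ℂ) : ℂ := -deriv (zeta Ω) u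

theorem sigmaFactor_bound {w : ℂ} (hw : ‖w‖ ≤ 1 / 2) :
    ‖(1 - w) * Complex.exp (w + (1 / 2) * w ^ 2) - 1‖ ≤ 49 * ‖w‖ ^ 3 := by
  set p : ℂ := w + (1 / 2) * w ^ 2 with hp
  have hw0 : 0 ≤ ‖w‖ := norm_nonneg w
  have hpn : ‖p‖ ≤ 2 * ‖w‖ := by
    calc ‖p‖ ≤ ‖w‖ + ‖(1 / 2) * w ^ 2‖ := norm_add_le _ _
      _ = ‖w‖ + (1 / 2) * ‖w‖ ^ 2 := by simp
      _ ≤ 2 * ‖w‖ := by nlinarith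
  have hp1 : ‖p‖ ≤ 1 := by linarith
  have h1 := Complex.norm_exp_sub_sum_le_norm_mul_exp p 3
  have he : Real.exp ‖p‖ ≤ 3 :=
    (Real.exp_le_exp.mpr hp1).trans (by linarith [Real.exp_one_lt_d9])
  have h2 : ‖p‖ ^ 3 ≤ 8 * ‖w‖ ^ 3 := by
    calc ‖p‖ ^ 3 ≤ (2 * ‖w‖) ^ 3 := by gcongr
      _ = 8 * ‖w‖ ^ 3 := by ring
  have h3 : ‖1 - w‖ ≤ 2 := (norm_sub_le _ _).trans (by simp; linarith)
  set S : ℂ := ∑ m ∈ Finset.range 3, p ^ m / (m.factorial : ℂ) with hS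
  have hid : (1 - w) * Complex.exp p - 1 =
      (1 - w) * (Complex.exp p - S) + w ^ 3 * (-(1 / 2) - 3 / 8 * w - 1 / 8 * w ^ 2) := by
    rw [hS]
    simp [Finset.sum_range_succ, Nat.factorial]
    rw [hp]
    ring
  have h4 : ‖-(1 / 2 : ℂ) - 3 / 8 * w - 1 / 8 * w ^ 2‖ ≤ 1 := by
    calc _ ≤ ‖(-(1 / 2 : ℂ))‖ + ‖3 / 8 * w‖ + ‖1 / 8 * w ^ 2‖ :=
          (norm_sub_le _ _).trans (add_le_add_left (norm_sub_le _ _) _)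
      _ = 1 / 2 + 3 / 8 * ‖w‖ + 1 / 8 * ‖w‖ ^ 2 := by simp
      _ ≤ 1 := by nlinarith
  rw [hid]
  calc _ ≤ ‖1 - w‖ * ‖Complex.exp p - S‖
        + ‖w‖ ^ 3 * ‖-(1 / 2 : ℂ) - 3 / 8 * w - 1 / 8 * w ^ 2‖ := by
        refine (norm_add_le _ _).trans (le_of_eq ?_)
        simp only [norm_mul, norm_pow]
    _ ≤ 2 * (8 * ‖w‖ ^ 3 * 3) + ‖w‖ ^ 3 * 1 := by
        gcongr
        exact h1.trans (by gcongr)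
    _ = 49 * ‖w‖ ^ 3 := by ring

theorem IsLattice.summable {Ω : AddSubgroup ℂ} (hΩ : IsLattice Ω) :
    Summable fun ω : {ω : Ω // ω ≠ 0} => ‖(ω.1 : ℂ)‖⁻¹ ^ 3 := by
  have : DiscreteTopology (AddSubgroup.toIntSubmodule Ω) := hΩ.1
  have h2 : Module.finrank ℤ (AddSubgroup.toIntSubmodule Ω) < 3 := by
    have : Module.finrank ℤ (AddSubgroup.toIntSubmodule Ω) = 2 := by
      simpa [Complex.finrank_real_complex] using! hΩ.2
    omega
  have := ZLattice.summable_norm_pow_inv (AddSubgroup.toIntSubmodule Ω) 3 h2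
  have h3 : Summable fun ω : Ω => ‖(ω : ℂ)‖⁻¹ ^ 3 := by simpa using! this
  exact h3.subtype _

theorem IsLattice.eventually {Ω : AddSubgroup ℂ} (hΩ : IsLattice Ω) (R : ℝ) :
    ∀ᶠ ω : {ω : Ω // ω ≠ 0} in cofinite, R ≤ ‖(ω.1 : ℂ)‖ := by
  have h := hΩ.summable.tendsto_cofinite_zero
  have hR : (0 : ℝ) < (|R| + 1)⁻¹ ^ 3 := by positivity
  filter_upwards [h.eventually (gt_mem_nhds hR)] with ω hω
  have h0 : 0 < ‖(ω.1 : ℂ)‖ := by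
    rw [norm_pos_iff]
    exact fun h => ω.2 (Subtype.ext h)
  have h1 : ‖(ω.1 : ℂ)‖⁻¹ < (|R| + 1)⁻¹ := lt_of_pow_lt_pow_left₀ 3 (by positivity) hω
  have h2 := (inv_lt_inv₀ h0 (by positivity)).mp h1
  linarith [le_abs_self R]

/-- The product that defines `σ` converges locally uniformly on `ℂ`. -/
theorem IsLattice.hasProd {Ω : AddSubgroup ℂ} (hΩ : IsLattice Ω) :
    HasProdLocallyUniformlyOn (fun (ω : {ω : Ω // ω ≠ 0}) u => sigmaFactor (ω.1 : ℂ) u)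
      (fun u => ∏' ω : {ω : Ω // ω ≠ 0}, sigmaFactor (ω.1 : ℂ) u) univ := by
  refine hasProdLocallyUniformlyOn_of_forall_compact isOpen_univ fun K _ hK => ?_
  obtain ⟨R, hR⟩ := hK.isBounded.exists_norm_le
  have := Summable.hasProdUniformlyOn_one_add (R := ℂ)
    (f := fun (ω : {ω : Ω // ω ≠ 0}) u => sigmaFactor (ω.1 : ℂ) u - 1) hK
    (hΩ.summable.mul_left (49 * |R| ^ 3)) ?_ ?_
  · simpa using this
  · filter_upwards [hΩ.eventually (2 * |R| + 1)] with ω hω u hu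
    have hu' : ‖u‖ ≤ |R| := (hR u hu).trans (le_abs_self R)
    have h0 : 0 < ‖(ω.1 : ℂ)‖ := by linarith [abs_nonneg R]
    have hw : ‖u / (ω.1 : ℂ)‖ ≤ 1 / 2 := by
      rw [norm_div, div_le_iff₀ h0]
      linarith
    refine (sigmaFactor_bound hw).trans ?_
    rw [norm_div, div_eq_mul_inv, mul_pow, ← mul_assoc]
    gcongr
  · intro ω
    unfold sigmaFactor
    fun_prop

theorem IsLattice.differentiable_sigma {Ω : AddSubgroup ℂ} (hΩ : IsLattice Ω) :
    Differentiable ℂ (sigma Ω) := by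
  have h : DifferentiableOn ℂ (fun u => ∏' ω : {ω : Ω // ω ≠ 0}, sigmaFactor (ω.1 : ℂ) u) univ :=
    hΩ.hasProd.differentiableOn
      (.of_forall fun _ => by
        simpa [Finset.prod_fn] using
          DifferentiableOn.finsetProd (fun _ _ => by unfold sigmaFactor; fun_prop)) isOpen_univ
  exact differentiable_id.mul (differentiableOn_univ.mp h)

/-- `σ` does not vanish off the lattice. -/
theorem IsLattice.sigma_ne_zero {Ω : AddSubgroup ℂ} (hΩ : IsLattice Ω) {u : ℂ} (hu : u ∉ Ω) :
    sigma Ω u ≠ 0 := by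
  refine mul_ne_zero (fun h => hu (h ▸ Ω.zero_mem)) ?_
  have := tprod_one_add_ne_zero_of_summable (R := ℂ)
    (f := fun ω : {ω : Ω // ω ≠ 0} => sigmaFactor (ω.1 : ℂ) u - 1) ?_ ?_
  · simpa using this
  · intro ω
    have h0 : (ω.1 : ℂ) ≠ 0 := fun h => ω.2 (Subtype.ext h)
    rw [add_sub_cancel]
    refine mul_ne_zero (sub_ne_zero.mpr fun h => hu ?_) (Complex.exp_ne_zero _)
    rw [eq_div_iff h0, one_mul] at h
    exact h ▸ ω.1.2
  · refine Summable.of_norm_bounded_eventually (hΩ.summable.mul_left (49 * ‖u‖ ^ 3)) ?_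
    filter_upwards [hΩ.eventually (2 * ‖u‖ + 1)] with ω hω
    have h0 : 0 < ‖(ω.1 : ℂ)‖ := by linarith [norm_nonneg u]
    have hw : ‖u / (ω.1 : ℂ)‖ ≤ 1 / 2 := by
      rw [norm_div, div_le_iff₀ h0]
      linarith
    rw [norm_norm]
    refine (sigmaFactor_bound hw).trans ?_
    rw [norm_div, div_eq_mul_inv, mul_pow, ← mul_assoc]

theorem IsLattice.exists_notMem {Ω : AddSubgroup ℂ} (hΩ : IsLattice Ω) : ∃ u : ℂ, u ∉ Ω := by
  by_contra! H
  have hd := hΩ.1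
  have : DiscreteTopology (univ : Set ℂ) := by
    have e : (Ω : Set ℂ) = univ := eq_univ_of_forall H
    rw [← e]
    exact hd
  have h := (Homeomorph.Set.univ ℂ).symm.isEmbedding.discreteTopology
  exact NeBot.ne (inferInstance : (𝓝[≠] (0 : ℂ)).NeBot) (discreteTopology_iff_nhds_ne.mp h 0)

/-! ## The entire functions that the families are built from -/

/-- The entire function `(u, v) ↦ s (u - a)` on `ℂ²`, for an entire function `s` of one variable. -/
def entireOfFst (s : ℂ → ℂ) (hs : Differentiable ℂ s) (a : ℂ) : Entire 2 :=
  Entire.mk (fun z => s (z 0 - a)) fun z _ =>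
    ((Complex.analyticAt_iff_eventually_differentiableAt.mpr
      (.of_forall fun w => hs w)).comp_of_eq
      (((ContinuousLinearMap.proj (R := ℂ) (φ := fun _ : Fin 2 => ℂ) 0).analyticAt z).sub
        analyticAt_const) rfl)

/-- The entire function `(u, v) ↦ s v` on `ℂ²`, for an entire function `s` of one variable. -/
def entireOfSnd (s : ℂ → ℂ) (hs : Differentiable ℂ s) : Entire 2 :=
  Entire.mk (fun z => s (z 1)) fun z _ =>
    ((Complex.analyticAt_iff_eventually_differentiableAt.mpr
      (.of_forall fun w => hs w)).comp_of_eq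
      ((ContinuousLinearMap.proj (R := ℂ) (φ := fun _ : Fin 2 => ℂ) 1).analyticAt z) rfl)

@[simp] theorem entireOfFst_apply (s : ℂ → ℂ) (hs : Differentiable ℂ s) (a : ℂ) (z : Fin 2 → ℂ) :
    entireOfFst s hs a z = s (z 0 - a) := rfl

@[simp] theorem entireOfSnd_apply (s : ℂ → ℂ) (hs : Differentiable ℂ s) (z : Fin 2 → ℂ) :
    entireOfSnd s hs z = s (z 1) := rfl

theorem IsMero.of_entire {n : ℕ} (g : Entire n) : IsMero g :=
  ⟨g, 1, one_ne_zero, fun z _ => by simp⟩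

theorem IsLattice.entire_sigma_ne_zero {Ω : AddSubgroup ℂ} (hΩ : IsLattice Ω) :
    entireOfFst (sigma Ω) hΩ.differentiable_sigma 0 ≠ 0 := by
  obtain ⟨u, hu⟩ := hΩ.exists_notMem
  intro h
  have := DFunLike.congr_fun h ![u, 0]
  exact hΩ.sigma_ne_zero hu (by simpa using this)

theorem isMero_fst : IsMero fun z : Fin 2 → ℂ => z 0 := by
  have h := IsMero.of_entire (entireOfFst id differentiable_id 0)
  have e : (entireOfFst id differentiable_id 0 : (Fin 2 → ℂ) → ℂ) = fun z => z 0 := by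
    ext z
    simp
  rwa [e] at h

theorem isMero_snd : IsMero fun z : Fin 2 → ℂ => z 1 :=
  IsMero.of_entire (entireOfSnd id differentiable_id)

theorem isMero_exp_fst : IsMero fun z : Fin 2 → ℂ => Complex.exp (z 0) := by
  have h := IsMero.of_entire (entireOfFst _ Complex.differentiable_exp 0)
  have e : (entireOfFst _ Complex.differentiable_exp 0 : (Fin 2 → ℂ) → ℂ) =
      fun z => Complex.exp (z 0) := by
    ext z
    simp
  rwa [e] at h

theorem isMero_exp_snd : IsMero fun z : Fin 2 → ℂ => Complex.exp (z 1) :=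
  IsMero.of_entire (entireOfSnd _ Complex.differentiable_exp)

theorem IsLattice.differentiable_deriv_sigma {Ω : AddSubgroup ℂ} (hΩ : IsLattice Ω) :
    Differentiable ℂ (deriv (sigma Ω)) := by
  have := hΩ.differentiable_sigma.differentiableOn (s := univ)
  exact differentiableOn_univ.mp (this.deriv isOpen_univ)

theorem IsLattice.differentiable_deriv_deriv_sigma {Ω : AddSubgroup ℂ} (hΩ : IsLattice Ω) :
    Differentiable ℂ (deriv (deriv (sigma Ω))) := by
  have := hΩ.differentiable_deriv_sigma.differentiableOn (s := univ)
  exact differentiableOn_univ.mp (this.deriv isOpen_univ)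

theorem IsLattice.isMero_wp {Ω : AddSubgroup ℂ} (hΩ : IsLattice Ω) :
    IsMero fun z : Fin 2 → ℂ => wp Ω (z 0) := by
  refine ⟨entireOfFst _ hΩ.differentiable_deriv_sigma 0 ^ 2 -
    entireOfFst _ hΩ.differentiable_deriv_deriv_sigma 0 *
      entireOfFst _ hΩ.differentiable_sigma 0,
    entireOfFst _ hΩ.differentiable_sigma 0 ^ 2, pow_ne_zero 2 hΩ.entire_sigma_ne_zero,
    fun z hz => ?_⟩
  have hz' : sigma Ω (z 0) ≠ 0 := by simpa using hz
  have e : wp Ω (z 0) = -((deriv (deriv (sigma Ω)) (z 0) * sigma Ω (z 0)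
      - deriv (sigma Ω) (z 0) * deriv (sigma Ω) (z 0)) / sigma Ω (z 0) ^ 2) :=
    congrArg Neg.neg (deriv_div (hΩ.differentiable_deriv_sigma (z 0))
      (hΩ.differentiable_sigma (z 0)) hz')
  simp only [e]
  simp
  field_simp
  ring

theorem IsLattice.isMero_zeta {Ω : AddSubgroup ℂ} (hΩ : IsLattice Ω) (a : ℂ) :
    IsMero fun z : Fin 2 → ℂ => z 1 - a * zeta Ω (z 0) := by
  refine ⟨entireOfSnd id differentiable_id * entireOfFst _ hΩ.differentiable_sigma 0 -
    a • entireOfFst _ hΩ.differentiable_deriv_sigma 0,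
    entireOfFst _ hΩ.differentiable_sigma 0, hΩ.entire_sigma_ne_zero, fun z hz => ?_⟩
  have hz' : sigma Ω (z 0) ≠ 0 := by simpa using hz
  simp [zeta]
  field_simp

theorem IsLattice.isMero_sigma {Ω : AddSubgroup ℂ} (hΩ : IsLattice Ω) (a : ℂ) :
    IsMero fun z : Fin 2 → ℂ => sigma Ω (z 0 - a) / sigma Ω (z 0) * Complex.exp (z 1) := by
  refine ⟨entireOfFst _ hΩ.differentiable_sigma a * entireOfSnd _ Complex.differentiable_exp,
    entireOfFst _ hΩ.differentiable_sigma 0, hΩ.entire_sigma_ne_zero, fun z hz => ?_⟩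
  have hz' : sigma Ω (z 0) ≠ 0 := by simpa using hz
  simp
  field_simp

/-! ## The meromorphic maps `g₁, …, g₅` and the families -/

/-- `g₁(u, v) = (u, v)` -/
def g1 : Fin 2 → Mero 2 := ![ofFun (fun z => z 0) isMero_fst, ofFun (fun z => z 1) isMero_snd]

/-- `g₂(u, v) = (exp u, v)` -/
def g2 : Fin 2 → Mero 2 :=
  ![ofFun (fun z => Complex.exp (z 0)) isMero_exp_fst, ofFun (fun z => z 1) isMero_snd]

/-- `g₃(u, v) = (exp u, exp v)` -/
def g3 : Fin 2 → Mero 2 :=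
  ![ofFun (fun z => Complex.exp (z 0)) isMero_exp_fst,
    ofFun (fun z => Complex.exp (z 1)) isMero_exp_snd]

/-- `g₄(u, v) = (℘(u), v - a ζ(u))` -/
def g4 (a : ℂ) (Ω : AddSubgroup ℂ) (hΩ : IsLattice Ω) : Fin 2 → Mero 2 :=
  ![ofFun (fun z => wp Ω (z 0)) hΩ.isMero_wp,
    ofFun (fun z => z 1 - a * zeta Ω (z 0)) (hΩ.isMero_zeta a)]

/-- `g₅(u, v) = (℘(u), (σ(u - a) / σ(u)) exp v)` -/
def g5 (a : ℂ) (Ω : AddSubgroup ℂ) (hΩ : IsLattice Ω) : Fin 2 → Mero 2 :=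
  ![ofFun (fun z => wp Ω (z 0)) hΩ.isMero_wp,
    ofFun (fun z => sigma Ω (z 0 - a) / sigma Ω (z 0) * Complex.exp (z 1)) (hΩ.isMero_sigma a)]

/-- The field `ℂ(g ∘ α)` for a meromorphic map `g` on `ℂ²` and `α ∈ GL₂(ℂ)`. -/
def fieldComp (g : Fin 2 → Mero 2) (α : GL (Fin 2) ℂ) : IntermediateField ℂ (Mero 2) :=
  fieldOf fun i => Mero.compGL α (g i)

/-- The family `{ℂ(g₁ ∘ α)}`. -/
def P1 : Set (IntermediateField ℂ (Mero 2)) := {L | ∃ α : GL (Fin 2) ℂ, L = fieldComp g1 α}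

/-- The family `{ℂ(g₂ ∘ α)}`. -/
def P2 : Set (IntermediateField ℂ (Mero 2)) := {L | ∃ α : GL (Fin 2) ℂ, L = fieldComp g2 α}

/-- The family `{ℂ(g₃ ∘ α)}`. -/
def P3 : Set (IntermediateField ℂ (Mero 2)) := {L | ∃ α : GL (Fin 2) ℂ, L = fieldComp g3 α}

/-- The family `{ℂ(g₄ ∘ α)}`, with `a ∈ {0, 1}` and `Ω` a lattice of `ℂ`. -/
def P4 : Set (IntermediateField ℂ (Mero 2)) :=
  {L | ∃ (α : GL (Fin 2) ℂ) (a : ℂ) (Ω : AddSubgroup ℂ) (hΩ : IsLattice Ω),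
    a ∈ ({0, 1} : Set ℂ) ∧ L = fieldComp (g4 a Ω hΩ) α}

/-- The family `{ℂ(g₅ ∘ α)}`, with `a ∈ ℂ` and `Ω` a lattice of `ℂ`. -/
def P5 : Set (IntermediateField ℂ (Mero 2)) :=
  {L | ∃ (α : GL (Fin 2) ℂ) (a : ℂ) (Ω : AddSubgroup ℂ) (hΩ : IsLattice Ω),
    L = fieldComp (g5 a Ω hΩ) α}

/-- The family of the fields `ℂ(Λ)` of transcendence degree `2`, with `Λ` a lattice of `ℂ²`. -/
def P6 : Set (IntermediateField ℂ (Mero 2)) :=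
  {L | ∃ Λ : AddSubgroup (Fin 2 → ℂ), IsLattice Λ ∧
    Algebra.trdeg ℂ (abelianFunctions Λ) = 2 ∧ L = abelianFunctions Λ}

end Painleve

end

noncomputable section

namespace Painleve

/-! The rank does not depend on the transcendence basis. If `x` is algebraic over `ℂ(f)`,
translation by a period of `f` fixes the coefficients of an equation for `x`, hence permutes its
finitely many roots, so a subgroup of finite index in the periods of `f` consists of periods of `x`
(`relIndex_periods_ne_zero`). Two bases with discrete period groups thus have period groups of the
same rank, and one good basis suffices (`hasZRank_of_isTranscendenceBasis`). The same finiteness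
yields independence: a function with a translation of infinite order modulo its periods, within the
periods of another function, is transcendental over that function
(`algebraicIndependent_of_periods`).

For the first five families the basis is `g ∘ α`, and `α` only moves the periods by a linear
isomorphism. The first coordinate of `g` depends on `u` alone, with period group `A`; over `u = 0`
the second coordinate has period group `B`. The periods of `g` are an extension of `A` by `B`, of
rank `rank A + rank B` (`hasZRank_of_slices`). Here `A` and `B` are trivial, `2πiℤ` or `Ω`. That
every `w ∈ Ω` lifts to a period is the quasi-periodicity of `ζ` and `σ`, which follows from the
periodicity of `℘` once the product for `σ` is matched with the usual series for `℘`.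

For the sixth family any transcendence basis has a period group containing `Λ`, so only discreteness
is at stake. A closed nondiscrete group contains a real line, and by analyticity a complex line of
periods. The functions then descend to one variable, still with a cocompact set of periods, and
counting zeros against monomials makes them algebraically dependent (`exists_algebraic_relation`), a
contradiction. -/

/-! ### Periods and algebraic dependence -/

theorem mem_periods {n : ℕ} {ι : Type*} {f : ι → Mero n} {a : Fin n → ℂ} :
    a ∈ periods f ↔ ∀ i, Mero.translate a (f i) = f i := Iff.rfl

theorem periods_eq_iInf {n : ℕ} {ι : Type*} (f : ι → Mero n) :
    periods f = ⨅ i, periods fun _ : Unit => f i := by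
  ext a
  simp [AddSubgroup.mem_iInf, mem_periods]

theorem translate_eq_translate_iff {n : ℕ} {x : Mero n} {a b : Fin n → ℂ} :
    Mero.translate a x = Mero.translate b x ↔ -a + b ∈ periods fun _ : Unit => x := by
  rw [mem_periods]
  refine ⟨fun h _ => ?_, fun h => ?_⟩
  · rw [← Mero.translate_translate, ← h, Mero.translate_translate, neg_add_cancel,
      Mero.translate_zero]
  · conv_lhs => rw [← h (), Mero.translate_translate, add_neg_cancel_left]

/-- If `x` is algebraic over `ℂ(f)`, then the translates of `x` by the periods of `f` are roots of
one polynomial, and so finite in number. -/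
theorem relIndex_periods_ne_zero {n : ℕ} {ι : Type*} {L : IntermediateField ℂ (Mero n)}
    (f : ι → L) {x : L} (hx : IsAlgebraic (Algebra.adjoin ℂ (range f)) x) :
    (periods fun _ : Unit => (x : Mero n)).relIndex (periods fun i => (f i : Mero n)) ≠ 0 := by
  obtain ⟨p, hp0, hp⟩ := hx
  let φ : Algebra.adjoin ℂ (range f) →+* Mero n :=
    (algebraMap L (Mero n)).comp (algebraMap (Algebra.adjoin ℂ (range f)) L)
  have hφ : Function.Injective φ :=
    (algebraMap L (Mero n)).injective.comp Subtype.val_injective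
  let q := p.map φ
  have hq : q ≠ 0 := (Polynomial.map_ne_zero_iff hφ).mpr hp0
  have hqx : q.eval (x : Mero n) = 0 := by
    have := congrArg (algebraMap L (Mero n)) hp
    rw [map_zero, Polynomial.aeval_def, Polynomial.hom_eval₂] at this
    rwa [Polynomial.eval_map]
  -- Periods of `f` fix every polynomial in `f`, in particular the coefficients of `q`.
  have hfix : ∀ a ∈ periods (fun i => (f i : Mero n)), ∀ c : Algebra.adjoin ℂ (range f),
      Mero.translate a (φ c) = φ c := by
    rintro a ha ⟨c, hc⟩
    change Mero.translate a (c : Mero n) = c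
    induction hc using Algebra.adjoin_induction with
    | mem y hy => obtain ⟨i, rfl⟩ := hy; exact ha i
    | algebraMap r => exact AlgHom.commutes (Mero.translate a) r
    | add y z _ _ hy hz => simp [map_add, hy, hz]
    | mul y z _ _ hy hz => simp [map_mul, hy, hz]
  have hroot : ∀ a ∈ periods (fun i => (f i : Mero n)),
      Mero.translate a (x : Mero n) ∈ q.rootSet (Mero n) := by
    intro a ha
    rw [Polynomial.mem_rootSet]
    refine ⟨hq, ?_⟩
    have h := congrArg (Mero.translate a : Mero n →+* Mero n) hqx
    rw [Polynomial.eval_map, Polynomial.hom_eval₂, map_zero] at h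
    have e : (Mero.translate a : Mero n →+* Mero n).comp φ = φ := RingHom.ext (hfix a ha)
    rw [e] at h
    rw [Polynomial.coe_aeval_eq_eval, Polynomial.eval_map]
    exact h
  have hfin : Finite (q.rootSet (Mero n)) := q.rootSet_finite (Mero n)
  let H := (periods fun _ : Unit => (x : Mero n)).addSubgroupOf (periods fun i => (f i : Mero n))
  let ψ : (periods fun i => (f i : Mero n)) ⧸ H → q.rootSet (Mero n) :=
    Quotient.lift (fun a => ⟨Mero.translate a.1 (x : Mero n), hroot a.1 a.2⟩) fun a b hab => by
      exact Subtype.ext (translate_eq_translate_iff.mpr 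
        ((QuotientAddGroup.leftRel_apply (s := H)).mp hab))
  have hψ : Function.Injective ψ := by
    rintro ⟨a⟩ ⟨b⟩ hab
    refine QuotientAddGroup.eq.mpr ?_
    exact translate_eq_translate_iff.mp (congrArg Subtype.val hab)
  have : Finite ((periods fun i => (f i : Mero n)) ⧸ H) := Finite.of_injective ψ hψ
  exact AddSubgroup.index_ne_zero_of_finite

/-- A discrete subgroup of finite relative index bounds the rank. -/
theorem finrank_le_of_relIndex_ne_zero {E : Type*} [NormedAddCommGroup E] [NormedSpace ℝ E]
    [FiniteDimensional ℝ E] {A B : AddSubgroup E} (hA : DiscreteTopology A)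
    (h : A.relIndex B ≠ 0) : Module.finrank ℤ B ≤ Module.finrank ℤ A := by
  have hd : DiscreteTopology (AddSubgroup.toIntSubmodule A) := hA
  have hfin : Module.Finite ℤ (AddSubgroup.toIntSubmodule A) := inferInstance
  have : Module.Finite ℤ A := hfin
  set m := A.relIndex B
  have hm : ∀ b : B, m • (b : E) ∈ A := fun b => by
    have := AddSubgroup.nsmul_index_mem (A.addSubgroupOf B) b
    simpa [AddSubgroup.mem_addSubgroupOf] using! this
  -- Multiplication by the relative index embeds `B` in `A`, since a real vector space is torsion
  -- free.
  let φ : B →+ A :=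
    { toFun := fun b => ⟨m • (b : E), hm b⟩
      map_zero' := by ext; simp
      map_add' := fun a b => by ext; simp }
  refine LinearMap.finrank_le_finrank_of_injective (f := φ.toIntLinearMap) fun a b hab => ?_
  have hab' : m • (a : E) = m • (b : E) := congrArg Subtype.val hab
  rw [← Nat.cast_smul_eq_nsmul ℝ, ← Nat.cast_smul_eq_nsmul ℝ] at hab'
  exact Subtype.ext (smul_right_injective E (Nat.cast_ne_zero.mpr h : (m : ℝ) ≠ 0) hab')

/-- Each `f i` is algebraic over `ℂ(g)`, so its periods have finite relative index in those of `g`,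
and a finite intersection of such groups still does. -/
theorem finrank_periods_le {n : ℕ} {ι κ : Type*} [Finite ι] {L : IntermediateField ℂ (Mero n)}
    {f : ι → L} {g : κ → L} (hg : IsTranscendenceBasis ℂ g)
    (hd : DiscreteTopology (periods fun i => (f i : Mero n))) :
    Module.finrank ℤ (periods fun i => (g i : Mero n)) ≤
      Module.finrank ℤ (periods fun i => (f i : Mero n)) := by
  refine finrank_le_of_relIndex_ne_zero hd ?_
  rw [periods_eq_iInf]
  have := hg.isAlgebraic
  exact AddSubgroup.relIndex_iInf_ne_zero fun i => relIndex_periods_ne_zero g (this.1 (f i))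

/-- The `ℤ`-rank can be read off from one transcendence basis. -/
theorem hasZRank_of_isTranscendenceBasis {n m : ℕ} {L : IntermediateField ℂ (Mero n)}
    {f : Fin n → L} (hf : IsTranscendenceBasis ℂ f)
    (hd : DiscreteTopology (periods fun i => (f i : Mero n)))
    (hm : Module.finrank ℤ (periods fun i => (f i : Mero n)) = m) : HasZRank L m := by
  refine ⟨?_, ⟨f, hf, hd⟩, fun g hg hgd => ?_⟩
  · simpa using hf.cardinalMk_eq_trdeg.symm
  · exact hm ▸ le_antisymm (finrank_periods_le hg hd) (finrank_periods_le hf hgd)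

/-- Functions are algebraically independent if the one has a period of infinite order modulo the
periods of the other, which is not constant. -/
theorem algebraicIndependent_of_periods {n : ℕ} {L : IntermediateField ℂ (Mero n)}
    (f : Fin 2 → L) (b₀ b₁ : Fin n → ℂ)
    (h₀ : ∀ k : ℕ, 0 < k → k • b₀ ∉ periods fun _ : Unit => (f 0 : Mero n))
    (h₁ : b₁ ∈ periods fun _ : Unit => (f 0 : Mero n))
    (h₂ : ∀ k : ℕ, 0 < k → k • b₁ ∉ periods fun _ : Unit => (f 1 : Mero n)) :
    AlgebraicIndependent ℂ f := by
  have i₀ : Transcendental ℂ (f 0) := by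
    intro h
    -- Constants are treated as generated by the empty family, of which every vector is a period.
    have h' : IsAlgebraic (Algebra.adjoin ℂ (range (Empty.elim : Empty → L))) (f 0) :=
      h.extendScalars (algebraMap ℂ _).injective
    obtain ⟨k, hk, -, hk'⟩ := AddSubgroup.exists_nsmul_mem_of_relIndex_ne_zero
      (relIndex_periods_ne_zero _ h') (a := b₀) (fun i => i.elim)
    exact h₀ k hk hk'.1
  have i₁ : AlgebraicIndependent ℂ (fun _ : Unit => f 0) :=
    (algebraicIndependent_unique_type_iff (ι := Unit)).mpr i₀
  have i₂ := (i₁.option_iff_transcendental (f 1)).mpr fun h => by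
    obtain ⟨k, hk, -, hk'⟩ := AddSubgroup.exists_nsmul_mem_of_relIndex_ne_zero
      (relIndex_periods_ne_zero _ h) (a := b₁) h₁
    exact h₂ k hk hk'.1
  have := i₂.comp (![some (), none] : Fin 2 → Option Unit) (by decide)
  convert this using 1
  ext i
  fin_cases i <;> rfl

/-! ## Linear changes of variables -/

theorem translate_compGL {n : ℕ} (α : GL (Fin n) ℂ) (a : Fin n → ℂ) (f : Mero n) :
    Mero.translate a (Mero.compGL α f) = Mero.compGL α (Mero.translate (α.1.mulVec a) f) := by
  obtain ⟨g, h, -, rfl⟩ := IsFractionRing.div_surjective (Entire n) f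
  refine (congrArg (Mero.translate a) (Mero.comp_div _ _ _ g h)).trans ?_
  refine (Mero.comp_div _ _ _ _ _).trans (Eq.trans ?_ (congrArg (Mero.compGL α)
    (Mero.comp_div _ _ _ g h)).symm)
  refine Eq.trans ?_ (Mero.comp_div _ _ _ _ _).symm
  congr 2 <;> exact DFunLike.ext _ _ fun z =>
    congrArg _ (Matrix.mulVec_add α.1 z a)

theorem mem_periods_compGL {n : ℕ} {ι : Type*} (α : GL (Fin n) ℂ) (f : ι → Mero n)
    (a : Fin n → ℂ) :
    (a ∈ periods fun i => Mero.compGL α (f i)) ↔ α.1.mulVec a ∈ periods f := by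
  simp only [mem_periods, translate_compGL]
  exact forall_congr' fun i => (Mero.compGL α).toRingHom.injective.eq_iff

theorem mulVec_inv_mulVec {n : ℕ} (α : GL (Fin n) ℂ) (a : Fin n → ℂ) :
    α.1.mulVec ((α⁻¹).1.mulVec a) = a := by
  rw [Matrix.mulVec_mulVec, ← Units.val_mul, mul_inv_cancel, Units.val_one, Matrix.one_mulVec]

theorem inv_mulVec_mulVec {n : ℕ} (α : GL (Fin n) ℂ) (a : Fin n → ℂ) :
    (α⁻¹).1.mulVec (α.1.mulVec a) = a := by
  rw [Matrix.mulVec_mulVec, ← Units.val_mul, inv_mul_cancel, Units.val_one, Matrix.one_mulVec]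

/-- The periods of `f ∘ α` are mapped by `α` onto the periods of `f`. -/
def periodsCompGLEquiv {n : ℕ} {ι : Type*} (α : GL (Fin n) ℂ) (f : ι → Mero n) :
    (periods fun i => Mero.compGL α (f i)) ≃+ periods f where
  toFun a := ⟨α.1.mulVec a, (mem_periods_compGL α f a).mp a.2⟩
  invFun a := ⟨(α⁻¹).1.mulVec a, (mem_periods_compGL α f _).mpr
    ((mulVec_inv_mulVec α a.1).symm ▸ a.2)⟩
  left_inv a := Subtype.ext (inv_mulVec_mulVec α a.1)
  right_inv a := Subtype.ext (mulVec_inv_mulVec α a.1)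
  map_add' a b := Subtype.ext (Matrix.mulVec_add α.1 a.1 b.1)

theorem discreteTopology_periods_compGL {n : ℕ} {ι : Type*} (α : GL (Fin n) ℂ) {f : ι → Mero n}
    (hf : DiscreteTopology (periods f)) :
    DiscreteTopology (periods fun i => Mero.compGL α (f i)) := by
  refine DiscreteTopology.of_continuous_injective (f := periodsCompGLEquiv α f) ?_
    (periodsCompGLEquiv α f).injective
  exact Continuous.subtype_mk (f := fun a : periods fun i => Mero.compGL α (f i) =>
      α.1.mulVec a.1)
    ((Matrix.mulVecLin α.1).toContinuousLinearMap.continuous.comp continuous_subtype_val) _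

/-- The `ℤ`-rank of `ℂ(g ∘ α)`, in terms of the periods of `g = (g₀, g₁)`. -/
theorem hasZRank_fieldComp {m : ℕ} (g : Fin 2 → Mero 2) (α : GL (Fin 2) ℂ) (b₀ b₁ : Fin 2 → ℂ)
    (h₀ : ∀ k : ℕ, 0 < k → k • b₀ ∉ periods fun _ : Unit => g 0)
    (h₁ : b₁ ∈ periods fun _ : Unit => g 0)
    (h₂ : ∀ k : ℕ, 0 < k → k • b₁ ∉ periods fun _ : Unit => g 1)
    (hd : DiscreteTopology (periods g)) (hm : Module.finrank ℤ (periods g) = m) :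
    HasZRank (fieldComp g α) m := by
  have hmem : ∀ i, Mero.compGL α (g i) ∈ fieldComp g α := fun i =>
    IntermediateField.subset_adjoin _ _ ⟨i, rfl⟩
  let f : Fin 2 → fieldComp g α := fun i => ⟨_, hmem i⟩
  have hper : ∀ i a, ((α⁻¹).1.mulVec a ∈ periods fun _ : Unit => (f i : Mero 2)) ↔
      a ∈ periods fun _ : Unit => g i := fun i a => by
    have := mem_periods_compGL α (fun _ : Unit => g i) ((α⁻¹).1.mulVec a)
    rwa [mulVec_inv_mulVec] at this
  have hf : AlgebraicIndependent ℂ f := by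
    refine algebraicIndependent_of_periods f ((α⁻¹).1.mulVec b₀) ((α⁻¹).1.mulVec b₁) ?_ ?_ ?_
    · intro k hk
      rw [← Matrix.mulVec_smul, hper]
      exact h₀ k hk
    · rwa [hper]
    · intro k hk
      rw [← Matrix.mulVec_smul, hper]
      exact h₂ k hk
  have hft : IsTranscendenceBasis ℂ f := by
    rw [hf.isTranscendenceBasis_iff_isAlgebraic]
    have htop : IntermediateField.adjoin ℂ (range f) = ⊤ := by
      rw [← IntermediateField.lift_injective _ |>.eq_iff, IntermediateField.lift_adjoin,
        IntermediateField.lift_top, ← range_comp]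
      rfl
    refine ⟨fun x => ?_⟩
    -- As `f` generates the field, `x` is a quotient of two polynomials in `f`.
    have hx : x ∈ IntermediateField.adjoin ℂ (range f) := htop ▸ IntermediateField.mem_top
    obtain ⟨r, s, e⟩ := (IntermediateField.mem_adjoin_range_iff ℂ f x).mp hx
    have h : ∀ p : MvPolynomial (Fin 2) ℂ,
        IsAlgebraic (Algebra.adjoin ℂ (range f)) (MvPolynomial.aeval f p) := fun p => by
      have : MvPolynomial.aeval f p ∈ Algebra.adjoin ℂ (range f) := by
        rw [Algebra.adjoin_range_eq_range_aeval]
        exact ⟨p, rfl⟩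
      exact isAlgebraic_algebraMap (⟨_, this⟩ : Algebra.adjoin ℂ (range f))
    rw [e, div_eq_mul_inv]
    exact (h r).mul (h s).inv
  refine hasZRank_of_isTranscendenceBasis hft (discreteTopology_periods_compGL α hd) ?_
  rw [← hm]
  exact LinearEquiv.finrank_eq (periodsCompGLEquiv α g).toIntLinearEquiv

/-! ## Lattices -/

/-- For a discrete group, the rank is the real dimension of the span. -/
theorem IsLattice.span_eq_top {E : Type*} [NormedAddCommGroup E] [NormedSpace ℝ E]
    [FiniteDimensional ℝ E] {Λ : AddSubgroup E} (hΛ : IsLattice Λ) :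
    Submodule.span ℝ (Λ : Set E) = ⊤ := by
  have hd : DiscreteTopology (AddSubgroup.toIntSubmodule Λ) := hΛ.1
  have hs : Submodule.span ℤ (Λ : Set E) = AddSubgroup.toIntSubmodule Λ :=
    Submodule.span_eq (AddSubgroup.toIntSubmodule Λ)
  have h := Real.finrank_eq_int_finrank_of_discrete (s := (Λ : Set E)) (by rw [hs]; exact hd)
  have h' : Set.finrank ℤ (Λ : Set E) = Module.finrank ℝ E := by
    rw [Set.finrank, hs]
    exact hΛ.2
  exact Submodule.eq_top_of_finrank_eq (h.trans h')

/-- A `ℤ`-basis of `Ω` is an `ℝ`-basis of `ℂ`; this gives access to the known periodicity of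
`PeriodPair.weierstrassP`. -/
theorem IsLattice.exists_periodPair {Ω : AddSubgroup ℂ} (hΩ : IsLattice Ω) :
    ∃ L : PeriodPair, ∀ u : ℂ, u ∈ L.lattice ↔ u ∈ Ω := by
  have hd : DiscreteTopology (AddSubgroup.toIntSubmodule Ω) := hΩ.1
  have hz : IsZLattice ℝ (AddSubgroup.toIntSubmodule Ω) := ⟨hΩ.span_eq_top⟩
  have hfr : Module.finrank ℤ (AddSubgroup.toIntSubmodule Ω) = 2 := by
    simpa [Complex.finrank_real_complex] using! hΩ.2
  let b : Module.Basis (Fin 2) ℤ (AddSubgroup.toIntSubmodule Ω) :=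
    Module.finBasisOfFinrankEq ℤ _ hfr
  have hli := (b.ofZLatticeBasis ℝ).linearIndependent
  have he : (![(b 0 : ℂ), (b 1 : ℂ)] : Fin 2 → ℂ) = b.ofZLatticeBasis ℝ := by
    ext i
    fin_cases i <;> simp
  refine ⟨⟨b 0, b 1, he ▸ hli⟩, fun u => ?_⟩
  have hspan := b.ofZLatticeBasis_span ℝ
  rw [← he, Matrix.range_cons, Matrix.range_cons, Matrix.range_empty, Set.union_empty,
    Set.singleton_union] at hspan
  rw [PeriodPair.lattice, hspan]
  rfl

theorem IsLattice.isOpen_compl {Ω : AddSubgroup ℂ} (hΩ : IsLattice Ω) :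
    IsOpen (Ω : Set ℂ)ᶜ := by
  have := hΩ.1
  exact (AddSubgroup.isClosed_of_discrete (H := Ω)).isOpen_compl

/-- Removing a countable set does not disconnect the plane. Hence a function with zero derivative
off `Ω` is constant there. -/
theorem IsLattice.isPreconnected_compl {Ω : AddSubgroup ℂ} (hΩ : IsLattice Ω) :
    IsPreconnected (Ω : Set ℂ)ᶜ := by
  have := hΩ.1
  refine (Set.Countable.isConnected_compl_of_one_lt_rank (by simp) ?_).isPreconnected
  exact countable_of_Lindelof_of_discrete (X := Ω)

theorem add_notMem {Ω : AddSubgroup ℂ} {u w : ℂ} (hw : w ∈ Ω) (hu : u ∉ Ω) : u + w ∉ Ω :=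
  fun h => hu (by simpa using Ω.sub_mem h hw)

/-! ## The Weierstrass functions -/

/-- The product in the definition of `σ`. -/
def sigmaProd (Ω : AddSubgroup ℂ) (u : ℂ) : ℂ := ∏' ω : {ω : Ω // ω ≠ 0}, sigmaFactor (ω.1 : ℂ) u

theorem sigma_zero (Ω : AddSubgroup ℂ) : sigma Ω 0 = 0 := by simp [sigma]

theorem sigmaProd_zero (Ω : AddSubgroup ℂ) : sigmaProd Ω 0 = 1 := by
  simp [sigmaProd, sigmaFactor]

theorem differentiable_sigmaFactor (ω : ℂ) : Differentiable ℂ (sigmaFactor ω) := by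
  unfold sigmaFactor
  fun_prop

theorem IsLattice.differentiable_sigmaProd {Ω : AddSubgroup ℂ} (hΩ : IsLattice Ω) :
    Differentiable ℂ (sigmaProd Ω) := by
  have h : DifferentiableOn ℂ (sigmaProd Ω) univ :=
    hΩ.hasProd.differentiableOn
      (.of_forall fun _ => by
        simpa [Finset.prod_fn] using DifferentiableOn.finsetProd
          (fun _ _ => (differentiable_sigmaFactor _).differentiableOn)) isOpen_univ
  exact differentiableOn_univ.mp h

theorem IsLattice.deriv_sigma_zero {Ω : AddSubgroup ℂ} (hΩ : IsLattice Ω) :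
    deriv (sigma Ω) 0 = 1 := by
  have := (hasDerivAt_id (0 : ℂ)).mul (hΩ.differentiable_sigmaProd 0).hasDerivAt
  have h := this.deriv
  simp only [id, zero_mul, add_zero, one_mul, sigmaProd_zero] at h
  exact h

theorem sigmaFactor_ne_zero {ω u : ℂ} (hω : ω ≠ 0) (hu : u ≠ ω) : sigmaFactor ω u ≠ 0 := by
  refine mul_ne_zero (sub_ne_zero.mpr fun h => hu ?_) (Complex.exp_ne_zero _)
  rw [eq_div_iff hω, one_mul] at h
  exact h.symm

theorem logDeriv_sigmaFactor {ω u : ℂ} (hω : ω ≠ 0) (hu : u ≠ ω) :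
    logDeriv (sigmaFactor ω) u = 1 / (u - ω) + (1 / ω + u / ω ^ 2) := by
  have h1 : 1 - u / ω ≠ 0 := left_ne_zero_of_mul (sigmaFactor_ne_zero hω hu)
  have hl : HasDerivAt (fun u : ℂ => 1 - u / ω) (-(1 / ω)) u := by
    simpa using ((hasDerivAt_id u).div_const ω).const_sub 1
  have he : HasDerivAt (fun u : ℂ => u / ω + (1 / 2) * (u / ω) ^ 2)
      (1 / ω + (1 / 2) * (2 * (u / ω) ^ 1 * (1 / ω))) u := by
    have h2 := (hasDerivAt_id u).div_const ω
    exact h2.add ((h2.pow 2).const_mul (1 / 2))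
  have h := (hl.mul he.cexp).deriv
  rw [logDeriv_apply]
  change deriv (sigmaFactor ω) u = _ at h
  rw [h, sigmaFactor]
  have h3 : u - ω ≠ 0 := sub_ne_zero.mpr hu
  have h4 : ω - u ≠ 0 := sub_ne_zero.mpr hu.symm
  have h5 : Complex.exp (u / ω + 1 / 2 * (u / ω) ^ 2) ≠ 0 := Complex.exp_ne_zero _
  have h6 : -(1 / ω) / (1 - u / ω) = 1 / (u - ω) := by
    rw [div_eq_div_iff h1 h3]
    field_simp
    ring
  rw [← h6]
  generalize Complex.exp (u / ω + 1 / 2 * (u / ω) ^ 2) = e at *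
  field_simp

/-- The right-hand side is continuous in the values of `f`, `f'` and `f''`, so it passes to limits
of products. -/
theorem deriv_logDeriv {f : ℂ → ℂ} (hf : Differentiable ℂ f) {u : ℂ} (hu : f u ≠ 0) :
    deriv (logDeriv f) u = (deriv (deriv f) u * f u - deriv f u * deriv f u) / f u ^ 2 := by
  have hf' : Differentiable ℂ (deriv f) :=
    differentiableOn_univ.mp (hf.differentiableOn.deriv isOpen_univ)
  exact deriv_div (hf' u) (hf u) hu

theorem IsLattice.deriv_logDeriv_finset_prod {Ω : AddSubgroup ℂ} (hΩ : IsLattice Ω)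
    (s : Finset {ω : Ω // ω ≠ 0}) {u : ℂ} (hu : u ∉ Ω) :
    deriv (logDeriv fun u => ∏ ω ∈ s, sigmaFactor (ω.1 : ℂ) u) u =
      -∑ ω ∈ s, (1 / (u - ω.1) ^ 2 - 1 / (ω.1 : ℂ) ^ 2) := by
  have h0 : ∀ ω : {ω : Ω // ω ≠ 0}, (ω.1 : ℂ) ≠ 0 := fun ω h => ω.2 (Subtype.ext h)
  have hne : ∀ v ∉ Ω, ∀ ω : {ω : Ω // ω ≠ 0}, v ≠ ω.1 := fun v hv ω h => hv (h ▸ ω.1.2)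
  have he : (logDeriv fun u => ∏ ω ∈ s, sigmaFactor (ω.1 : ℂ) u) =ᶠ[𝓝 u]
      fun v => ∑ ω ∈ s, (1 / (v - ω.1) + (1 / (ω.1 : ℂ) + v / (ω.1 : ℂ) ^ 2)) := by
    filter_upwards [hΩ.isOpen_compl.mem_nhds hu] with v hv
    rw [logDeriv_prod (fun ω _ => sigmaFactor_ne_zero (h0 ω) (hne v hv ω))
      (fun ω _ => differentiable_sigmaFactor _ v)]
    exact Finset.sum_congr rfl fun ω _ => logDeriv_sigmaFactor (h0 ω) (hne v hv ω)
  rw [he.deriv_eq, ← Finset.sum_neg_distrib]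
  refine (HasDerivAt.fun_sum fun ω _ => ?_).deriv
  have h1 : u - ω.1 ≠ 0 := sub_ne_zero.mpr (hne u hu ω)
  have h2 := ((hasDerivAt_id u).sub_const (ω.1 : ℂ)).inv h1
  have h3 := ((hasDerivAt_id u).div_const ((ω.1 : ℂ) ^ 2)).const_add (1 / (ω.1 : ℂ))
  have h4 := h2.add h3
  simp only [id] at h4
  convert h4 using 1
  · ext v
    simp [one_div]
  · ring

/-- The finite products converge locally uniformly, hence so do their first two derivatives; the
finite identity `deriv_logDeriv_finset_prod` passes to the limit. -/
theorem IsLattice.deriv_logDeriv_sigmaProd {Ω : AddSubgroup ℂ} (hΩ : IsLattice Ω)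
    {L : PeriodPair} (hL : ∀ u : ℂ, u ∈ L.lattice ↔ u ∈ Ω) {u : ℂ} (hu : u ∉ Ω) :
    deriv (logDeriv (sigmaProd Ω)) u = -L.weierstrassPExcept 0 u := by
  have hP : sigmaProd Ω u ≠ 0 := right_ne_zero_of_mul (hΩ.sigma_ne_zero hu)
  set F : Finset {ω : Ω // ω ≠ 0} → ℂ → ℂ := fun s v => ∏ ω ∈ s, sigmaFactor (ω.1 : ℂ) v
  have hF : ∀ s, Differentiable ℂ (F s) := fun s =>
    Differentiable.fun_finsetProd fun ω _ => differentiable_sigmaFactor _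
  have hF' : ∀ s, Differentiable ℂ (deriv (F s)) := fun s =>
    differentiableOn_univ.mp ((hF s).differentiableOn.deriv isOpen_univ)
  have t0 : TendstoLocallyUniformlyOn F (sigmaProd Ω) atTop univ := hΩ.hasProd
  have t1 := t0.deriv (.of_forall fun s => (hF s).differentiableOn) isOpen_univ
  have t2 := t1.deriv (.of_forall fun s => (hF' s).differentiableOn) isOpen_univ
  have p0 := t0.tendsto_at (mem_univ u)
  have p1 := t1.tendsto_at (mem_univ u)
  have p2 := t2.tendsto_at (mem_univ u)
  have hlim := ((p2.mul p0).sub (p1.mul p1)).div (p0.pow 2) (pow_ne_zero 2 hP)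
  rw [← deriv_logDeriv hΩ.differentiable_sigmaProd hP] at hlim
  refine tendsto_nhds_unique hlim ?_
  let e : {ω : Ω // ω ≠ 0} ≃ {l : L.lattice | l ≠ 0} :=
    { toFun := fun ω => ⟨⟨ω.1, (hL _).mpr ω.1.2⟩, fun h => ω.2 (by simpa using h)⟩
      invFun := fun l => ⟨⟨l.1, (hL _).mp l.1.2⟩, fun h => l.2 (by simpa using h)⟩
      left_inv := fun _ => rfl
      right_inv := fun _ => rfl }
  have hs := L.hasSum_weierstrassPExcept 0 u
  -- The excepted term at `0` vanishes, so the series runs over the same index set as the product.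
  rw [← hasSum_subtype_iff_of_support_subset (s := {l : L.lattice | l ≠ 0}), ← e.hasSum_iff] at hs
  · refine Tendsto.congr (fun s => ?_) hs.neg
    have hFu : F s u ≠ 0 := Finset.prod_ne_zero_iff.mpr fun ω _ =>
      sigmaFactor_ne_zero (fun h => ω.2 (Subtype.ext h)) fun h => hu (h ▸ ω.1.2)
    have h1 := hΩ.deriv_logDeriv_finset_prod s hu
    rw [deriv_logDeriv (hF s) hFu, ← Finset.sum_neg_distrib] at h1
    refine Eq.trans ?_ h1.symm
    refine Finset.sum_congr rfl fun ω _ => ?_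
    have : (ω.1 : ℂ) ≠ 0 := fun h => ω.2 (Subtype.ext h)
    simp [e, this]
  · intro l hl h
    rw [h] at hl
    simp at hl

/-- The factor `u` of `σ` contributes `1 / u` to `ζ`, hence `1 / u ^ 2` to `℘`: the term at `0`
missing from the product. -/
theorem IsLattice.wp_eq {Ω : AddSubgroup ℂ} (hΩ : IsLattice Ω)
    {L : PeriodPair} (hL : ∀ u : ℂ, u ∈ L.lattice ↔ u ∈ Ω) {u : ℂ} (hu : u ∉ Ω) :
    wp Ω u = L.weierstrassP u := by
  have he : zeta Ω =ᶠ[𝓝 u] fun v => v⁻¹ + logDeriv (sigmaProd Ω) v := by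
    filter_upwards [hΩ.isOpen_compl.mem_nhds hu] with v hv
    have h := hΩ.sigma_ne_zero hv
    have := logDeriv_mul (f := id) (g := sigmaProd Ω) v (left_ne_zero_of_mul h)
      (right_ne_zero_of_mul h) differentiableAt_id (hΩ.differentiable_sigmaProd v)
    rw [logDeriv_id, one_div] at this
    exact this
  have h := hΩ.sigma_ne_zero hu
  have hd : DifferentiableAt ℂ (logDeriv (sigmaProd Ω)) u := by
    have hf' : Differentiable ℂ (deriv (sigmaProd Ω)) := differentiableOn_univ.mp
      (hΩ.differentiable_sigmaProd.differentiableOn.deriv isOpen_univ)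
    exact (hf' u).div (hΩ.differentiable_sigmaProd u) (right_ne_zero_of_mul h)
  have h2 := ((hasDerivAt_inv (left_ne_zero_of_mul h)).add hd.hasDerivAt).deriv
  have h3 : deriv (zeta Ω) u = _ := he.deriv_eq.trans h2
  rw [wp, h3, hΩ.deriv_logDeriv_sigmaProd hL hu, ← L.weierstrassPExcept_add 0]
  simp

theorem IsLattice.wp_add {Ω : AddSubgroup ℂ} (hΩ : IsLattice Ω) {u w : ℂ} (hw : w ∈ Ω)
    (hu : u ∉ Ω) : wp Ω (u + w) = wp Ω u := by
  obtain ⟨L, hL⟩ := hΩ.exists_periodPair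
  rw [hΩ.wp_eq hL hu, hΩ.wp_eq hL (add_notMem hw hu)]
  exact L.weierstrassP_add_coe u ⟨w, (hL w).mpr hw⟩

theorem IsLattice.differentiableAt_zeta {Ω : AddSubgroup ℂ} (hΩ : IsLattice Ω) {u : ℂ}
    (hu : u ∉ Ω) : DifferentiableAt ℂ (zeta Ω) u :=
  (hΩ.differentiable_deriv_sigma u).div (hΩ.differentiable_sigma u) (hΩ.sigma_ne_zero hu)

/-- `ζ` is quasi-periodic. -/
theorem IsLattice.exists_zeta_add {Ω : AddSubgroup ℂ} (hΩ : IsLattice Ω) {w : ℂ} (hw : w ∈ Ω) :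
    ∃ η : ℂ, ∀ u ∉ Ω, zeta Ω (u + w) = zeta Ω u + η := by
  have hd : ∀ u ∉ Ω, HasDerivAt (fun u => zeta Ω (u + w) - zeta Ω u) 0 u := fun u hu => by
    have h1 := (hΩ.differentiableAt_zeta (add_notMem hw hu)).hasDerivAt.comp_add_const u w
    have h2 := h1.sub (hΩ.differentiableAt_zeta hu).hasDerivAt
    have h3 : deriv (zeta Ω) (u + w) - deriv (zeta Ω) u = 0 := by
      have := hΩ.wp_add hw hu
      simp only [wp, neg_inj] at this
      rw [this, sub_self]
    rw [h3] at h2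
    exact h2
  obtain ⟨η, hη⟩ := hΩ.isOpen_compl.exists_is_const_of_deriv_eq_zero hΩ.isPreconnected_compl
    (fun u hu => (hd u hu).differentiableAt.differentiableWithinAt) fun u hu => (hd u hu).deriv
  exact ⟨η, fun u hu => by rw [← hη u hu]; ring⟩

/-- `σ` is quasi-periodic. -/
theorem IsLattice.exists_sigma_add {Ω : AddSubgroup ℂ} (hΩ : IsLattice Ω) {w : ℂ} (hw : w ∈ Ω) :
    ∃ C η : ℂ, C ≠ 0 ∧ ∀ u, sigma Ω (u + w) = C * Complex.exp (η * u) * sigma Ω u := by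
  obtain ⟨η, hη⟩ := hΩ.exists_zeta_add hw
  -- The logarithmic derivative of `q` is `ζ(u + w) - η - ζ(u) = 0`.
  let q : ℂ → ℂ := fun u => sigma Ω (u + w) * Complex.exp (-(η * u)) / sigma Ω u
  have hd : ∀ u ∉ Ω, HasDerivAt q 0 u := fun u hu => by
    have h0 := hΩ.sigma_ne_zero hu
    have h0' := hΩ.sigma_ne_zero (add_notMem hw hu)
    have h1 := (hΩ.differentiable_sigma (u + w)).hasDerivAt.comp_add_const u w
    have h2 : HasDerivAt (fun u : ℂ => -(η * u)) (-(η * 1)) u :=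
      ((hasDerivAt_id u).const_mul η).neg
    have h3 := (h1.mul h2.cexp).div (hΩ.differentiable_sigma u).hasDerivAt h0
    refine h3.congr_deriv ?_
    have h4 := hη u hu
    simp only [zeta] at h4
    rw [div_eq_iff h0'] at h4
    rw [div_eq_zero_iff]
    left
    rw [h4, Pi.mul_apply]
    field_simp
    ring
  obtain ⟨C, hC⟩ := hΩ.isOpen_compl.exists_is_const_of_deriv_eq_zero hΩ.isPreconnected_compl
    (fun u hu => (hd u hu).differentiableAt.differentiableWithinAt) fun u hu => (hd u hu).deriv
  have key : ∀ u ∉ Ω, sigma Ω (u + w) = C * Complex.exp (η * u) * sigma Ω u := fun u hu => by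
    have h := hC u hu
    simp only [q] at h
    rw [div_eq_iff (hΩ.sigma_ne_zero hu), Complex.exp_neg] at h
    field_simp at h
    rw [h]
    ring_nf
  obtain ⟨u₀, hu₀⟩ := hΩ.exists_notMem
  refine ⟨C, η, ?_, fun u => ?_⟩
  · rintro rfl
    have := key u₀ hu₀
    simp only [zero_mul] at this
    exact hΩ.sigma_ne_zero (add_notMem hw hu₀) this
  -- Both sides are continuous, so the identity extends to the points of `Ω`.
  · have hdense : Dense (Ω : Set ℂ)ᶜ := by
      have := hΩ.1
      exact Set.Countable.dense_compl ℝ (countable_of_Lindelof_of_discrete (X := Ω))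
    have hc := hΩ.differentiable_sigma.continuous
    refine congrFun (Continuous.ext_on hdense (hc.comp (continuous_add_const w)) ?_ key) u
    fun_prop

theorem IsLattice.mem_of_sigma_eq_zero {Ω : AddSubgroup ℂ} (hΩ : IsLattice Ω) {u : ℂ}
    (h : sigma Ω u = 0) : u ∈ Ω := by
  by_contra hu
  exact hΩ.sigma_ne_zero hu h

/-! ## Subgroups of `ℂ²` that are extensions of discrete subgroups of `ℂ` -/

section Slices

variable {S : AddSubgroup (Fin 2 → ℂ)} {A B : AddSubgroup ℂ}

/-- Near `0` the first coordinate must vanish because `A` is discrete; only then does the second lie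
in `B`, and it vanishes too. -/
theorem discreteTopology_of_slices (hA : DiscreteTopology A) (hB : DiscreteTopology B)
    (hSA : ∀ z ∈ S, z 0 ∈ A) (hSB : ∀ z ∈ S, z 0 = 0 → z 1 ∈ B) : DiscreteTopology S := by
  refine discreteTopology_of_isOpen_singleton_zero ?_
  obtain ⟨U, hU, hUA⟩ := isOpen_induced_iff.mp (isOpen_discrete ({0} : Set A))
  obtain ⟨V, hV, hVB⟩ := isOpen_induced_iff.mp (isOpen_discrete ({0} : Set B))
  have e : ({0} : Set S) = {z : S | z.1 0 ∈ U ∧ z.1 1 ∈ V} := by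
    ext z
    constructor
    · rintro rfl
      exact ⟨hUA.ge (mem_singleton 0), hVB.ge (mem_singleton 0)⟩
    · rintro ⟨h0, h1⟩
      have e0 : z.1 0 = 0 :=
        congrArg Subtype.val (hUA.le (show (⟨z.1 0, hSA z z.2⟩ : A) ∈ _ from h0))
      have e1 : z.1 1 = 0 :=
        congrArg Subtype.val (hVB.le (show (⟨z.1 1, hSB z z.2 e0⟩ : B) ∈ _ from h1))
      refine Subtype.ext (funext fun i => ?_)
      fin_cases i
      exacts [e0, e1]
  rw [e]
  exact (hU.preimage ((continuous_apply 0).comp continuous_subtype_val)).inter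
    (hV.preimage ((continuous_apply 1).comp continuous_subtype_val))

/-- The first projection maps `S` onto `A` with kernel isomorphic to `B`, and rank is additive. -/
theorem finrank_of_slices (hS : DiscreteTopology S) (hSA : ∀ z ∈ S, z 0 ∈ A)
    (hAS : ∀ w ∈ A, ∃ c : ℂ, ![w, c] ∈ S) (hSB : ∀ z : Fin 2 → ℂ, z 0 = 0 → (z ∈ S ↔ z 1 ∈ B)) :
    Module.finrank ℤ S = Module.finrank ℤ A + Module.finrank ℤ B := by
  have hd : DiscreteTopology (AddSubgroup.toIntSubmodule S) := hS
  have hfin : Module.Finite ℤ (AddSubgroup.toIntSubmodule S) := inferInstance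
  have : Module.Finite ℤ S := hfin
  let π : S →ₗ[ℤ] A := AddMonoidHom.toIntLinearMap
    { toFun := fun z => ⟨z.1 0, hSA z z.2⟩
      map_zero' := rfl
      map_add' := fun _ _ => rfl }
  have hker : ∀ z : S, z ∈ LinearMap.ker π ↔ z.1 0 = 0 := fun z =>
    LinearMap.mem_ker.trans Subtype.ext_iff
  have hsurj : Function.Surjective π := fun w => by
    obtain ⟨c, hc⟩ := hAS w w.2
    exact ⟨⟨_, hc⟩, rfl⟩
  let e : LinearMap.ker π ≃+ B :=
    { toFun := fun z => ⟨z.1.1 1, (hSB z.1.1 ((hker z.1).mp z.2)).mp z.1.2⟩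
      invFun := fun b => ⟨⟨![0, b], (hSB _ rfl).mpr b.2⟩, (hker _).mpr rfl⟩
      left_inv := fun z => by
        refine Subtype.ext (Subtype.ext (funext fun i => ?_))
        fin_cases i
        exacts [((hker z.1).mp z.2).symm, rfl]
      right_inv := fun _ => rfl
      map_add' := fun _ _ => rfl }
  rw [← Submodule.finrank_quotient_add_finrank (LinearMap.ker π),
    (π.quotKerEquivOfSurjective hsurj).finrank_eq, e.toIntLinearEquiv.finrank_eq]

/-- The points with a positive multiple in the countable group `A` form a countable set. -/
theorem exists_nsmul_notMem (hA : DiscreteTopology A) :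
    ∃ x : ℂ, ∀ k : ℕ, 0 < k → k • x ∉ A := by
  have hc : (A : Set ℂ).Countable := countable_of_Lindelof_of_discrete (X := A)
  have hu : (⋃ k : {k : ℕ // 0 < k}, (fun x : ℂ => (k : ℕ) • x) ⁻¹' (A : Set ℂ)).Countable :=
    countable_iUnion fun k => hc.preimage fun x y h => by
      have : (k.1 : ℂ) ≠ 0 := Nat.cast_ne_zero.mpr k.2.ne'
      simpa [nsmul_eq_mul, this] using h
  obtain ⟨x, hx⟩ := (hu.dense_compl ℝ).nonempty
  exact ⟨x, fun k hk h => hx (mem_iUnion.mpr ⟨⟨k, hk⟩, h⟩)⟩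

/-- The `ℤ`-rank of `ℂ(g ∘ α)`, if the first coordinate of `g` depends on `u` only. -/
theorem hasZRank_of_slices (g : Fin 2 → Mero 2) (α : GL (Fin 2) ℂ)
    (hA : DiscreteTopology A) (hB : DiscreteTopology B)
    (h₀ : ∀ z, (z ∈ periods fun _ : Unit => g 0) ↔ z 0 ∈ A)
    (h₁ : ∀ z : Fin 2 → ℂ, z 0 = 0 → ((z ∈ periods fun _ : Unit => g 1) ↔ z 1 ∈ B))
    (h₂ : ∀ w ∈ A, ∃ c : ℂ, ![w, c] ∈ periods fun _ : Unit => g 1) :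
    HasZRank (fieldComp g α) (Module.finrank ℤ A + Module.finrank ℤ B) := by
  have hp : ∀ z, z ∈ periods g ↔
      z 0 ∈ A ∧ z ∈ periods fun _ : Unit => g 1 := fun z => by
    rw [← h₀, mem_periods, Fin.forall_fin_two, mem_periods, mem_periods, forall_const, forall_const]
  have hd : DiscreteTopology (periods g) := discreteTopology_of_slices hA hB
    (fun z hz => ((hp z).mp hz).1) fun z hz h => (h₁ z h).mp ((hp z).mp hz).2
  obtain ⟨x, hx⟩ := exists_nsmul_notMem hA
  obtain ⟨y, hy⟩ := exists_nsmul_notMem hB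
  -- `(x, 0)` has infinite order modulo the periods of `g 0`; `(0, y)` is a period of `g 0` but has
  -- infinite order modulo those of `g 1`.
  refine hasZRank_fieldComp g α ![x, 0] ![0, y] ?_ ?_ ?_ hd ?_
  · intro k hk h
    exact hx k hk ((h₀ _).mp h)
  · exact (h₀ _).mpr A.zero_mem
  · intro k hk h
    exact hy k hk ((h₁ _ (by simp)).mp h)
  · refine finrank_of_slices hd (fun z hz => ((hp z).mp hz).1) (fun w hw => ?_) fun z hz => ?_
    · obtain ⟨c, hc⟩ := h₂ w hw
      exact ⟨c, (hp _).mpr ⟨hw, hc⟩⟩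
    · rw [hp, h₁ z hz, hz]
      exact and_iff_right A.zero_mem

end Slices

/-! ## The periods of the coordinates of `g₁, …, g₅` -/

theorem mem_periods_ofFun {n : ℕ} {F : (Fin n → ℂ) → ℂ} (hF : IsMero F) {g h : Entire n}
    (H : IsQuotient F g h) (a : Fin n → ℂ) :
    (a ∈ periods fun _ : Unit => ofFun F hF) ↔ ∀ b, g b * h (b + a) = h b * g (b + a) := by
  rw [ofFun_eq hF H, mem_periods_div_iff (fun _ => g) (fun _ => h) fun _ => H.1]
  exact forall_const _

theorem mem_periods_ofFun_entire {n : ℕ} {F : (Fin n → ℂ) → ℂ} (hF : IsMero F) (g : Entire n)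
    (hg : ∀ z, F z = g z) (a : Fin n → ℂ) :
    (a ∈ periods fun _ : Unit => ofFun F hF) ↔ ∀ b, F (b + a) = F b := by
  rw [mem_periods_ofFun hF (g := g) (h := 1) ⟨one_ne_zero, fun z _ => by simp [hg]⟩]
  simp [hg, eq_comm]

/-- The group of periods of the exponential function. -/
def expPeriods : AddSubgroup ℂ := AddSubgroup.zmultiples (2 * Real.pi * Complex.I)

theorem mem_expPeriods {c : ℂ} : c ∈ expPeriods ↔ Complex.exp c = 1 := by
  rw [Complex.exp_eq_one_iff, expPeriods, AddSubgroup.mem_zmultiples_iff]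
  simp [eq_comm]

theorem discreteTopology_expPeriods : DiscreteTopology expPeriods :=
  NormedSpace.discreteTopology_zmultiples _

theorem finrank_expPeriods : Module.finrank ℤ expPeriods = 1 := by
  have h := (LinearEquiv.toSpanNonzeroSingleton ℤ ℂ _ Complex.two_pi_I_ne_zero).finrank_eq
  have e : AddSubgroup.toIntSubmodule expPeriods = ℤ ∙ (2 * Real.pi * Complex.I : ℂ) := by
    ext c
    rw [Submodule.mem_span_singleton]
    exact AddSubgroup.mem_zmultiples_iff
  rw [Module.finrank_self, ← e] at h
  exact h.symm

theorem forall_exp_add_iff {ι : Type*} {s : ι → ℂ} [Nonempty ι] {c : ℂ} :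
    (∀ b, Complex.exp (s b + c) = Complex.exp (s b)) ↔ c ∈ expPeriods := by
  simp [mem_expPeriods, Complex.exp_add]

theorem discreteTopology_bot : DiscreteTopology (⊥ : AddSubgroup ℂ) := inferInstance

theorem finrank_bot : Module.finrank ℤ (⊥ : AddSubgroup ℂ) = 0 :=
  Module.finrank_zero_of_subsingleton

theorem mem_periods_fst {a : Fin 2 → ℂ} :
    (a ∈ periods fun _ : Unit => ofFun _ isMero_fst) ↔ a 0 ∈ (⊥ : AddSubgroup ℂ) := by
  rw [mem_periods_ofFun_entire _ (entireOfFst id differentiable_id 0) (by simp)]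
  simp

theorem mem_periods_snd {a : Fin 2 → ℂ} :
    (a ∈ periods fun _ : Unit => ofFun _ isMero_snd) ↔ a 1 ∈ (⊥ : AddSubgroup ℂ) := by
  rw [mem_periods_ofFun_entire _ (entireOfSnd id differentiable_id) (by simp)]
  simp

theorem mem_periods_exp_fst {a : Fin 2 → ℂ} :
    (a ∈ periods fun _ : Unit => ofFun _ isMero_exp_fst) ↔ a 0 ∈ expPeriods := by
  rw [mem_periods_ofFun_entire _ (entireOfFst _ Complex.differentiable_exp 0) (by simp)]
  exact forall_exp_add_iff

theorem mem_periods_exp_snd {a : Fin 2 → ℂ} :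
    (a ∈ periods fun _ : Unit => ofFun _ isMero_exp_snd) ↔ a 1 ∈ expPeriods := by
  rw [mem_periods_ofFun_entire _ (entireOfSnd _ Complex.differentiable_exp) (by simp)]
  exact forall_exp_add_iff

/-- Periodicity need only be tested away from the zeros of both denominators: the identity principle
extends the cross-multiplied identity across them. -/
theorem mem_periods_ofFun_iff {n : ℕ} {F : (Fin n → ℂ) → ℂ} (hF : IsMero F) {g h : Entire n}
    (H : IsQuotient F g h) (a : Fin n → ℂ) :
    (a ∈ periods fun _ : Unit => ofFun F hF) ↔
      ∀ b, h b ≠ 0 → h (b + a) ≠ 0 → F (b + a) = F b := by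
  rw [mem_periods_ofFun hF H]
  refine ⟨fun K b h0 h1 => ?_, fun K => ?_⟩
  · rw [H.2 b h0, H.2 _ h1, div_eq_div_iff h1 h0]
    linear_combination -K b
  · have hφ : AnalyticOnNhd ℂ (fun z : Fin n → ℂ => z + a) univ :=
      analyticOnNhd_id.add analyticOnNhd_const
    have hs : Function.Surjective fun z : Fin n → ℂ => z + a :=
      fun z => ⟨z - a, sub_add_cancel z a⟩
    have h0 : Entire.comp _ hφ h ≠ 0 := by
      rw [Ne, map_eq_zero_iff _ (Entire.comp_injective hφ hs)]
      exact H.1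
    have := Entire.eq_zero_of_mul (mul_ne_zero H.1 h0)
      (g := g * Entire.comp _ hφ h - h * Entire.comp _ hφ g) fun z hz => by
        have h1 : h z ≠ 0 := left_ne_zero_of_mul hz
        have h2 : h (z + a) ≠ 0 := right_ne_zero_of_mul hz
        have h3 := K z h1 h2
        rw [H.2 z h1, H.2 _ h2, div_eq_div_iff h2 h1] at h3
        rw [Entire.sub_apply, Entire.mul_apply, Entire.mul_apply, Entire.comp_apply,
          Entire.comp_apply]
        linear_combination -h3
    exact fun b => sub_eq_zero.mp (DFunLike.congr_fun this b)

theorem IsLattice.sigma_eq_zero_iff {Ω : AddSubgroup ℂ} (hΩ : IsLattice Ω) {u : ℂ} :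
    sigma Ω u = 0 ↔ u ∈ Ω := by
  refine ⟨hΩ.mem_of_sigma_eq_zero, fun hu => ?_⟩
  obtain ⟨C, η, -, h⟩ := hΩ.exists_sigma_add hu
  simpa [sigma_zero] using h 0

theorem IsLattice.isQuotient_wp {Ω : AddSubgroup ℂ} (hΩ : IsLattice Ω) :
    IsQuotient (fun z : Fin 2 → ℂ => wp Ω (z 0))
      (entireOfFst _ hΩ.differentiable_deriv_sigma 0 ^ 2 -
        entireOfFst _ hΩ.differentiable_deriv_deriv_sigma 0 *
          entireOfFst _ hΩ.differentiable_sigma 0)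
      (entireOfFst _ hΩ.differentiable_sigma 0 ^ 2) := by
  refine ⟨pow_ne_zero 2 hΩ.entire_sigma_ne_zero, fun z hz => ?_⟩
  have hz' : sigma Ω (z 0) ≠ 0 := by simpa using hz
  have e : wp Ω (z 0) = -((deriv (deriv (sigma Ω)) (z 0) * sigma Ω (z 0)
      - deriv (sigma Ω) (z 0) * deriv (sigma Ω) (z 0)) / sigma Ω (z 0) ^ 2) :=
    congrArg Neg.neg (deriv_div (hΩ.differentiable_deriv_sigma (z 0))
      (hΩ.differentiable_sigma (z 0)) hz')
  simp only [e, Entire.sub_apply, Entire.mul_apply, Entire.pow_apply, entireOfFst_apply, sub_zero]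
  ring

theorem IsLattice.mem_periods_wp {Ω : AddSubgroup ℂ} (hΩ : IsLattice Ω) {a : Fin 2 → ℂ} :
    (a ∈ periods fun _ : Unit => ofFun _ hΩ.isMero_wp) ↔ a 0 ∈ Ω := by
  constructor
  · intro h
    -- At `0`, where `σ = 0` and `σ' = 1`, the cross-multiplied identity reads `σ (a 0) ^ 2 = 0`.
    have := (mem_periods_ofFun _ hΩ.isQuotient_wp a).mp h 0
    simpa [sigma_zero, hΩ.deriv_sigma_zero, hΩ.sigma_eq_zero_iff] using this
  · intro h
    rw [mem_periods_ofFun_iff _ hΩ.isQuotient_wp]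
    intro b hb _
    refine hΩ.wp_add h fun hb' => hb ?_
    simp [hΩ.sigma_eq_zero_iff.mpr hb']

theorem IsLattice.mem_periods_zeta_iff {Ω : AddSubgroup ℂ} (hΩ : IsLattice Ω) (a : ℂ)
    (z : Fin 2 → ℂ) :
    (z ∈ periods fun _ : Unit => ofFun _ (hΩ.isMero_zeta a)) ↔ ∀ b : Fin 2 → ℂ, b 0 ∉ Ω →
      b 0 + z 0 ∉ Ω → b 1 + z 1 - a * zeta Ω (b 0 + z 0) = b 1 - a * zeta Ω (b 0) := by
  rw [mem_periods_ofFun_iff _ (g := entireOfSnd id differentiable_id *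
    entireOfFst _ hΩ.differentiable_sigma 0 - a • entireOfFst _ hΩ.differentiable_deriv_sigma 0)
    (h := entireOfFst _ hΩ.differentiable_sigma 0)
    ⟨hΩ.entire_sigma_ne_zero, fun z hz => by
      have hz' : sigma Ω (z 0) ≠ 0 := by simpa using hz
      simp only [zeta, Entire.sub_apply, Entire.mul_apply, Entire.smul_apply, entireOfFst_apply,
        entireOfSnd_apply, sub_zero, id]
      field_simp⟩]
  simp [hΩ.sigma_eq_zero_iff]

theorem IsLattice.mem_periods_sigma_iff {Ω : AddSubgroup ℂ} (hΩ : IsLattice Ω) (a : ℂ)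
    (z : Fin 2 → ℂ) :
    (z ∈ periods fun _ : Unit => ofFun _ (hΩ.isMero_sigma a)) ↔ ∀ b : Fin 2 → ℂ, b 0 ∉ Ω →
      b 0 + z 0 ∉ Ω →
      sigma Ω (b 0 + z 0 - a) / sigma Ω (b 0 + z 0) * Complex.exp (b 1 + z 1) =
        sigma Ω (b 0 - a) / sigma Ω (b 0) * Complex.exp (b 1) := by
  rw [mem_periods_ofFun_iff _ (g := entireOfFst _ hΩ.differentiable_sigma a *
    entireOfSnd _ Complex.differentiable_exp) (h := entireOfFst _ hΩ.differentiable_sigma 0)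
    ⟨hΩ.entire_sigma_ne_zero, fun z hz => by
      have hz' : sigma Ω (z 0) ≠ 0 := by simpa using hz
      simp only [Entire.mul_apply, entireOfFst_apply, entireOfSnd_apply, sub_zero]
      field_simp⟩]
  simp [hΩ.sigma_eq_zero_iff]

/-! ## The families `P1, …, P5` -/

theorem familyHasZRank_P1 : FamilyHasZRank P1 0 := by
  rintro _ ⟨α, rfl⟩
  have h := hasZRank_of_slices g1 α discreteTopology_bot discreteTopology_bot
    (fun _ => mem_periods_fst) (fun _ _ => mem_periods_snd)
    fun w _ => ⟨0, mem_periods_snd.mpr (AddSubgroup.zero_mem _)⟩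
  rwa [finrank_bot] at h

theorem familyHasZRank_P2 : FamilyHasZRank P2 1 := by
  rintro _ ⟨α, rfl⟩
  have h := hasZRank_of_slices g2 α discreteTopology_expPeriods discreteTopology_bot
    (fun _ => mem_periods_exp_fst) (fun _ _ => mem_periods_snd)
    fun w _ => ⟨0, mem_periods_snd.mpr (AddSubgroup.zero_mem _)⟩
  rwa [finrank_bot, finrank_expPeriods] at h

theorem familyHasZRank_P3 : FamilyHasZRank P3 2 := by
  rintro _ ⟨α, rfl⟩
  have h := hasZRank_of_slices g3 α discreteTopology_expPeriods discreteTopology_expPeriods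
    (fun _ => mem_periods_exp_fst) (fun _ _ => mem_periods_exp_snd)
    fun w _ => ⟨0, mem_periods_exp_snd.mpr (AddSubgroup.zero_mem _)⟩
  rwa [finrank_expPeriods] at h

theorem IsLattice.finrank_eq_two {Ω : AddSubgroup ℂ} (hΩ : IsLattice Ω) :
    Module.finrank ℤ Ω = 2 :=
  hΩ.2.trans Complex.finrank_real_complex

theorem familyHasZRank_P4 : FamilyHasZRank P4 2 := by
  rintro _ ⟨α, a, Ω, hΩ, -, rfl⟩
  have h := hasZRank_of_slices (g4 a Ω hΩ) α hΩ.1 discreteTopology_bot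
    (fun _ => hΩ.mem_periods_wp) (fun z hz => ?_) fun w hw => ?_
  · rwa [finrank_bot, hΩ.finrank_eq_two] at h
  · refine (hΩ.mem_periods_zeta_iff a z).trans ?_
    rw [AddSubgroup.mem_bot, hz]
    constructor
    · intro H
      obtain ⟨u, hu⟩ := hΩ.exists_notMem
      simpa using H ![u, 0] hu (by simpa using hu)
    · intro H b _ _
      rw [H, add_zero, add_zero]
  · obtain ⟨η, hη⟩ := hΩ.exists_zeta_add hw
    -- The shift of `v` absorbs the increment `a * η` of `a * ζ`.
    refine ⟨a * η, (hΩ.mem_periods_zeta_iff a _).mpr fun b hb _ => ?_⟩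
    simp only [Matrix.cons_val_zero, Matrix.cons_val_one]
    rw [hη _ hb]
    ring

theorem familyHasZRank_P5 : FamilyHasZRank P5 3 := by
  rintro _ ⟨α, a, Ω, hΩ, rfl⟩
  have h := hasZRank_of_slices (g5 a Ω hΩ) α hΩ.1 discreteTopology_expPeriods
    (fun _ => hΩ.mem_periods_wp) (fun z hz => ?_) fun w hw => ?_
  · rwa [finrank_expPeriods, hΩ.finrank_eq_two] at h
  · refine (hΩ.mem_periods_sigma_iff a z).trans ?_
    rw [mem_expPeriods, hz]
    constructor
    · intro H
      have := hΩ.1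
      have hc : (Ω : Set ℂ).Countable := countable_of_Lindelof_of_discrete (X := Ω)
      -- A point outside `Ω` and `Ω + a`, so that the quotient of the two `σ`-values can be
      -- cancelled.
      obtain ⟨u, hu⟩ := ((hc.union
        (hc.preimage (sub_left_injective (b := a)))).dense_compl ℝ).nonempty
      simp only [mem_compl_iff, mem_union, mem_preimage, SetLike.mem_coe, not_or] at hu
      have h1 := hΩ.sigma_ne_zero hu.1
      have h2 := hΩ.sigma_ne_zero hu.2
      have h3 := H ![u, 0] hu.1 (by simpa using hu.1)
      simp only [Matrix.cons_val_zero, Matrix.cons_val_one, add_zero, zero_add, Complex.exp_zero,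
        mul_one] at h3
      exact (mul_eq_left₀ (div_ne_zero h2 h1)).mp h3
    · intro H b _ _
      rw [Complex.exp_add, H, add_zero, mul_one]
  · obtain ⟨C, η, hC, h⟩ := hΩ.exists_sigma_add hw
    -- Adding `w` to `u` multiplies `σ(u - a) / σ(u)` by `exp (-(η * a))`.
    refine ⟨η * a, (hΩ.mem_periods_sigma_iff a _).mpr fun b hb _ => ?_⟩
    simp only [Matrix.cons_val_zero, Matrix.cons_val_one]
    have h0 := hΩ.sigma_ne_zero hb
    rw [add_sub_right_comm, h, h, mul_sub, Complex.exp_sub, Complex.exp_add]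
    have h1 := Complex.exp_ne_zero (η * a)
    have h2 := Complex.exp_ne_zero (η * b 0)
    field_simp

/-! ## Division of entire functions of one variable -/

theorem analyticOrderAt_ne_top_of_ne_zero {D : ℂ → ℂ} (hD : Differentiable ℂ D) {z₁ : ℂ}
    (hz₁ : D z₁ ≠ 0) (z : ℂ) : analyticOrderAt D z ≠ ⊤ := by
  intro h
  rw [analyticOrderAt_eq_top] at h
  have hA : AnalyticOnNhd ℂ D univ := fun z _ => hD.analyticAt z
  exact hz₁ (congrFun (hA.eq_of_eventuallyEq (analyticOnNhd_const (v := (0 : ℂ))) h) z₁)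

theorem eventually_ne_zero_of_ne_zero {D : ℂ → ℂ} (hD : Differentiable ℂ D) {z₁ : ℂ}
    (hz₁ : D z₁ ≠ 0) (z : ℂ) : ∀ᶠ w in 𝓝[≠] z, D w ≠ 0 := by
  refine (hD.analyticAt z).eventually_eq_zero_or_eventually_ne_zero.resolve_left fun h => ?_
  exact analyticOrderAt_ne_top_of_ne_zero hD hz₁ z (analyticOrderAt_eq_top.mpr h)

theorem exists_eventuallyEq_mul {D E : ℂ → ℂ} (hD : Differentiable ℂ D)
    (hE : Differentiable ℂ E) {z₁ : ℂ} (hz₁ : D z₁ ≠ 0) {z : ℂ}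
    (h : analyticOrderAt D z ≤ analyticOrderAt E z) :
    ∃ r : ℂ → ℂ, AnalyticAt ℂ r z ∧ ∀ᶠ w in 𝓝 z, E w = D w * r w := by
  obtain ⟨d, hd, hdz, hDd⟩ :=
    (hD.analyticAt z).analyticOrderAt_ne_top.mp (analyticOrderAt_ne_top_of_ne_zero hD hz₁ z)
  rw [← Nat.cast_analyticOrderNatAt (analyticOrderAt_ne_top_of_ne_zero hD hz₁ z)] at h
  obtain ⟨e, he, hEe⟩ := (natCast_le_analyticOrderAt (hE.analyticAt z)).mp h
  refine ⟨fun w => e w / d w, he.div hd hdz, ?_⟩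
  filter_upwards [hDd, hEe, hd.continuousAt.eventually_ne hdz] with w h1 h2 h3
  rw [h1, h2, smul_eq_mul, smul_eq_mul]
  field_simp

/-- The order inequality makes all singularities of `E / D` removable; `z₁` only witnesses that `D`
is not identically zero. -/
theorem exists_eq_mul {D E : ℂ → ℂ} (hD : Differentiable ℂ D)
    (hE : Differentiable ℂ E) {z₁ : ℂ} (hz₁ : D z₁ ≠ 0)
    (h : ∀ z, analyticOrderAt D z ≤ analyticOrderAt E z) :
    ∃ q : ℂ → ℂ, Differentiable ℂ q ∧ ∀ w, E w = D w * q w := by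
  choose r hr hEr using fun z => exists_eventuallyEq_mul hD hE hz₁ (h z)
  -- Near `z` the local quotient `r z` agrees with the diagonal values: at `z` by definition,
  -- elsewhere by cancelling `D w ≠ 0`.
  refine ⟨fun z => r z z, fun z => ?_, fun w => (hEr w).self_of_nhds⟩
  refine DifferentiableAt.congr_of_eventuallyEq (hr z).differentiableAt ?_
  refine eventuallyEq_nhds_of_eventuallyEq_nhdsNE ?_ rfl
  filter_upwards [eventually_ne_zero_of_ne_zero hD hz₁ z,
    (hEr z).filter_mono nhdsWithin_le_nhds] with w h1 h2
  exact mul_left_cancel₀ h1 ((hEr w).self_of_nhds.symm.trans h2)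

theorem analyticOrderAt_comp_add (f : ℂ → ℂ) (z γ : ℂ) :
    analyticOrderAt (fun w => f (w + γ)) z = analyticOrderAt f (z + γ) := by
  have hg : AnalyticAt ℂ (fun w : ℂ => w + γ) z := by fun_prop
  have h := analyticOrderAt_comp_of_deriv_ne_zero (f := f) hg (by simp)
  exact h

/-- A quotient of entire functions with a cocompact set of periods is constant, if it has no poles
in a large ball. -/
theorem exists_eq_const_mul_of_periods {D E : ℂ → ℂ} (hD : Differentiable ℂ D)
    (hE : Differentiable ℂ E) {z₁ : ℂ} (hz₁ : D z₁ ≠ 0) {Γ : Set ℂ} {R : ℝ}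
    (hΓ : ∀ z, ∃ γ ∈ Γ, ‖z + γ‖ ≤ R) (hper : ∀ γ ∈ Γ, ∀ w, E w * D (w + γ) = E (w + γ) * D w)
    (hord : ∀ z, ‖z‖ ≤ R → analyticOrderAt D z ≤ analyticOrderAt E z) :
    ∃ c : ℂ, ∀ w, E w = c * D w := by
  have hdense : Dense {w | D w ≠ 0} := by
    intro z
    rw [mem_closure_iff_frequently]
    exact (eventually_ne_zero_of_ne_zero hD hz₁ z).frequently.filter_mono nhdsWithin_le_nhds
  -- A period moves `z` into the ball, and comparing orders in `hper` carries the inequality back to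
  -- `z`.
  obtain ⟨q, hq, hEq⟩ := exists_eq_mul hD hE hz₁ fun z => by
    obtain ⟨γ, hγ, hz⟩ := hΓ z
    have h1 := hord _ hz
    have hDγ : Differentiable ℂ fun w => D (w + γ) := by fun_prop
    have hEγ : Differentiable ℂ fun w => E (w + γ) := by fun_prop
    have h2 := congrArg (analyticOrderAt · z) (funext (hper γ hγ))
    have h3 : analyticOrderAt E z + analyticOrderAt D (z + γ) =
        analyticOrderAt E (z + γ) + analyticOrderAt D z := by
      rw [← analyticOrderAt_comp_add D, ← analyticOrderAt_comp_add E,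
        ← analyticOrderAt_mul (hE.analyticAt z) (hDγ.analyticAt z),
        ← analyticOrderAt_mul (hEγ.analyticAt z) (hD.analyticAt z)]
      exact h2
    have h4 := analyticOrderAt_ne_top_of_ne_zero hD hz₁ (z + γ)
    refine (ENat.add_le_add_iff_left h4).mp ?_
    calc _ ≤ analyticOrderAt E (z + γ) + analyticOrderAt D z := by gcongr
      _ = _ := by rw [← h3, add_comm]
  have hqper : ∀ γ ∈ Γ, ∀ w, q (w + γ) = q w := fun γ hγ => by
    have hd2 : Dense {w | D w * D (w + γ) ≠ 0} := by
      intro z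
      rw [mem_closure_iff_frequently]
      have : ∀ᶠ w in 𝓝[≠] z, D w * D (w + γ) ≠ 0 := by
        filter_upwards [eventually_ne_zero_of_ne_zero hD hz₁ z,
          eventually_ne_zero_of_ne_zero (D := fun w => D (w + γ)) (by fun_prop)
            (z₁ := z₁ - γ) (by simpa using hz₁) z] with w h1 h2
        exact mul_ne_zero h1 h2
      exact this.frequently.filter_mono nhdsWithin_le_nhds
    refine congrFun (Continuous.ext_on hd2 (hq.continuous.comp (continuous_add_const γ))
      hq.continuous fun w hw => ?_)
    have h := hper γ hγ w
    rw [hEq w, hEq (w + γ)] at h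
    refine mul_left_cancel₀ hw ?_
    linear_combination -h
  obtain ⟨C, hC⟩ := (isCompact_closedBall (0 : ℂ) R).exists_bound_of_continuousOn
    hq.continuous.continuousOn
  -- All values of `q` are attained in the ball, so Liouville's theorem applies.
  obtain ⟨c, hc⟩ := hq.exists_const_forall_eq_of_bounded (isBounded_iff_forall_norm_le.mpr ⟨C, by
    rintro _ ⟨z, rfl⟩
    obtain ⟨γ, hγ, hz⟩ := hΓ z
    rw [← hqper γ hγ]
    exact hC _ (by simpa using hz)⟩)
  exact ⟨c, fun w => by rw [hEq, hc, mul_comm]⟩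

/-- Quotients `E i / D` with a cocompact set of periods are linearly dependent, if there are more
of them than `D` has zeros in a large ball. -/
theorem exists_linear_relation {ι : Type*} [Fintype ι] {E : ι → ℂ → ℂ} {D : ℂ → ℂ}
    (hD : Differentiable ℂ D) (hE : ∀ i, Differentiable ℂ (E i)) {z₁ : ℂ} (hz₁ : D z₁ ≠ 0)
    {Γ : Set ℂ} {R : ℝ} (hΓ : ∀ z, ∃ γ ∈ Γ, ‖z + γ‖ ≤ R)
    (hper : ∀ γ ∈ Γ, ∀ i w, E i w * D (w + γ) = E i (w + γ) * D w)
    {Z : Finset ℂ} (hZ : ∀ z, ‖z‖ ≤ R → D z = 0 → z ∈ Z)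
    (hcard : 1 + ∑ z ∈ Z, analyticOrderNatAt D z < Fintype.card ι) :
    ∃ c : ι → ℂ, c ≠ 0 ∧ ∀ w, ∑ i, c i * E i w = 0 := by
  -- One linear condition for each zero of `D` with multiplicity cancels the poles; the extra one,
  -- vanishing at `z₁`, forces the resulting constant to be `0`.
  let J := Option (Σ z : Z, Fin (analyticOrderNatAt D z.1))
  let a : ι → J → ℂ := fun i j => j.elim (E i z₁) fun p => iteratedDeriv p.2 (E i) p.1
  let T : (ι → ℂ) →ₗ[ℂ] (J → ℂ) := Fintype.linearCombination ℂ a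
  have hT : LinearMap.ker T ≠ ⊥ := by
    refine LinearMap.ker_ne_bot_of_finrank_lt ?_
    rw [Module.finrank_fintype_fun_eq_card, Module.finrank_fintype_fun_eq_card,
      Fintype.card_option, Fintype.card_sigma]
    simp only [Fintype.card_fin]
    rw [Finset.sum_coe_sort Z fun z => analyticOrderNatAt D z, add_comm]
    exact hcard
  obtain ⟨c, hc, hc0⟩ := Submodule.exists_mem_ne_zero_of_ne_bot hT
  have hTc : ∀ j, ∑ i, c i * a i j = 0 := fun j => by
    have := congrFun (LinearMap.mem_ker.mp hc) j
    simpa [T, Fintype.linearCombination_apply] using this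
  refine ⟨c, hc0, ?_⟩
  set S : ℂ → ℂ := fun w => ∑ i, c i * E i w with hS
  have hSd : Differentiable ℂ S := by fun_prop
  obtain ⟨k, hk⟩ := exists_eq_const_mul_of_periods hD hSd hz₁ hΓ
    (fun γ hγ w => by
      simp only [hS, Finset.sum_mul]
      refine Finset.sum_congr rfl fun i _ => ?_
      linear_combination c i * hper γ hγ i w)
    fun z hz => by
      by_cases hDz : D z = 0
      · rw [← Nat.cast_analyticOrderNatAt (analyticOrderAt_ne_top_of_ne_zero hD hz₁ z),
          natCast_le_analyticOrderAt_iff_iteratedDeriv_eq_zero (hSd.analyticAt z)]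
        intro m hm
        have h := hTc (some ⟨⟨z, hZ z hz hDz⟩, ⟨m, hm⟩⟩)
        rw [← h, hS, iteratedDeriv_fun_sum fun i _ =>
          (contDiff_const.mul (hE i).contDiff).contDiffAt]
        exact Finset.sum_congr rfl fun i _ => iteratedDeriv_const_mul_field _ _
      · rw [(hD.analyticAt z).analyticOrderAt_eq_zero.mpr hDz]
        exact zero_le
  have h0 := hTc none
  have h1 : k * D z₁ = 0 := (hk z₁).symm.trans h0
  intro w
  refine (hk w).trans ?_
  rw [(mul_eq_zero.mp h1).resolve_right hz₁, zero_mul]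

/-- The monomial `(x₀ / h) ^ i * (x₁ / h) ^ j`, where `i, j ≤ N`, times `h ^ (2 * N)`. -/
def homMonomial {R : Type*} [CommRing R] {N : ℕ} (p : Fin (N + 1) × Fin (N + 1)) (x : Fin 2 → R)
    (h : R) : R :=
  (x 0 ^ (p.1 : ℕ) * h ^ (N - p.1)) * (x 1 ^ (p.2 : ℕ) * h ^ (N - p.2))

theorem map_homMonomial {R S : Type*} [CommRing R] [CommRing S] (φ : R →+* S) {N : ℕ}
    (p : Fin (N + 1) × Fin (N + 1)) (x : Fin 2 → R) (h : R) :
    φ (homMonomial p x h) = homMonomial p (fun i => φ (x i)) (φ h) := by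
  simp [homMonomial]

/-- Each of the two factors is homogeneous of degree `N`, so over `h ^ (2 * N)` the monomial depends
only on the ratios `x i / h`; this is stated without division. -/
theorem homMonomial_mul_pow {R : Type*} [CommRing R] {N : ℕ} (p : Fin (N + 1) × Fin (N + 1))
    {x x' : Fin 2 → R} {h h' : R} (H : ∀ i, x i * h' = x' i * h) :
    homMonomial p x h * h' ^ (2 * N) = homMonomial p x' h' * h ^ (2 * N) := by
  have key : ∀ i, ∀ k : Fin (N + 1), (x i ^ (k : ℕ) * h ^ (N - k)) * h' ^ N =
      (x' i ^ (k : ℕ) * h' ^ (N - k)) * h ^ N := fun i k => by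
    have hk : (k : ℕ) + (N - k) = N := Nat.add_sub_cancel' (Nat.lt_succ_iff.mp k.2)
    have h1 := congrArg (· ^ (k : ℕ)) (H i)
    simp only [mul_pow] at h1
    have e : ∀ y : R, y ^ N = y ^ (k : ℕ) * y ^ (N - k) := fun y => by rw [← pow_add, hk]
    rw [e, e]
    linear_combination (h ^ (N - k) * h' ^ (N - k)) * h1
  have h0 := key 0 p.1
  have h1 := key 1 p.2
  simp only [homMonomial, two_mul, pow_add]
  linear_combination (x 1 ^ (p.2 : ℕ) * h ^ (N - p.2)) * h' ^ N * h0 +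
    (x' 0 ^ (p.1 : ℕ) * h' ^ (N - p.1)) * h ^ N * h1

/-- Two quotients of entire functions of one variable with a cocompact set of common periods are
algebraically dependent. -/
theorem exists_algebraic_relation {G : Fin 2 → ℂ → ℂ} {H : ℂ → ℂ} (hH : Differentiable ℂ H)
    (hG : ∀ i, Differentiable ℂ (G i)) {z₁ : ℂ} (hz₁ : H z₁ ≠ 0)
    {Γ : Set ℂ} {R : ℝ} (hΓ : ∀ z, ∃ γ ∈ Γ, ‖z + γ‖ ≤ R)
    (hper : ∀ γ ∈ Γ, ∀ i w, G i w * H (w + γ) = G i (w + γ) * H w) :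
    ∃ (N : ℕ) (c : Fin (N + 1) × Fin (N + 1) → ℂ), c ≠ 0 ∧
      ∀ w, ∑ p, c p * homMonomial p (fun i => G i w) (H w) = 0 := by
  have hfin : (Metric.closedBall (0 : ℂ) R ∩ {z | H z = 0}).Finite := by
    have h := AnalyticOnNhd.preimage_zero_mem_codiscrete (f := H)
      (fun z _ => hH.analyticAt z) (x := z₁) hz₁
    have h2 := (isCompact_closedBall (0 : ℂ) R).finite_sdiff_of_mem_codiscreteWithin
      (codiscreteWithin_mono (subset_univ _) h)
    refine h2.subset fun z hz => ⟨hz.1, fun h => h hz.2⟩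
  let M := ∑ z ∈ hfin.toFinset, analyticOrderNatAt H z
  -- `H ^ (2 * N)` has `2 * N * M = N * (N - 1)` zeros in the ball, against `(N + 1) ^ 2` monomials.
  let N := 2 * M + 1
  refine ⟨N, ?_⟩
  refine exists_linear_relation (D := fun w => H w ^ (2 * N)) (by fun_prop)
    (fun p => by unfold homMonomial; fun_prop)
    (pow_ne_zero _ hz₁) hΓ (fun γ hγ p w => homMonomial_mul_pow p fun i => hper γ hγ i w)
    (Z := hfin.toFinset) (fun z hz h => ?_) ?_
  · rw [Set.Finite.mem_toFinset]
    exact ⟨by simpa using hz, pow_eq_zero_iff (by omega) |>.mp h⟩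
  · have e : ∀ z, analyticOrderNatAt (fun w => H w ^ (2 * N)) z =
        2 * N * analyticOrderNatAt H z := fun z => analyticOrderNatAt_pow (hH.analyticAt z) _
    simp only [e, ← Finset.mul_sum, Fintype.card_prod, Fintype.card_fin]
    change 1 + 2 * (2 * M + 1) * M < (2 * M + 1 + 1) * (2 * M + 1 + 1)
    nlinarith

/-! ## Closed subgroups that are not discrete -/

theorem exists_norm_lt_of_not_discreteTopology {E : Type*} [NormedAddCommGroup E]
    {S : AddSubgroup E} (hd : ¬DiscreteTopology S) {ε : ℝ} (hε : 0 < ε) :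
    ∃ a ∈ S, a ≠ 0 ∧ ‖a‖ < ε := by
  by_contra! H
  refine hd (discreteTopology_of_isOpen_singleton_zero ?_)
  have e : ({0} : Set S) = {a : S | ‖(a : E)‖ < ε} := by
    ext a
    refine ⟨fun h => ?_, fun h => ?_⟩
    · rw [mem_singleton_iff.mp h]
      simpa using hε
    · by_contra ha
      exact absurd h (not_lt.mpr (H a a.2 fun h' => ha (Subtype.ext h')))
  rw [e]
  exact isOpen_lt (by fun_prop) continuous_const

/-- A closed subgroup that is not discrete contains a line. -/
theorem exists_line_of_not_discreteTopology {E : Type*} [NormedAddCommGroup E] [NormedSpace ℝ E]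
    [FiniteDimensional ℝ E] {S : AddSubgroup E} (hc : IsClosed (S : Set E))
    (hd : ¬DiscreteTopology S) : ∃ w : E, w ≠ 0 ∧ ∀ t : ℝ, t • w ∈ S := by
  choose a haS ha0 ha using fun n : ℕ =>
    exists_norm_lt_of_not_discreteTopology hd (Nat.one_div_pos_of_nat (α := ℝ) (n := n))
  have hpos : ∀ n, 0 < ‖a n‖ := fun n => norm_pos_iff.mpr (ha0 n)
  have hlim : Tendsto (fun n => ‖a n‖) atTop (𝓝 0) :=
    squeeze_zero (fun n => norm_nonneg _) (fun n => (ha n).le)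
      tendsto_one_div_add_atTop_nhds_zero_nat
  have : ProperSpace E := FiniteDimensional.proper ℝ E
  obtain ⟨w, hw, φ, hφ, hφw⟩ := (isCompact_sphere (0 : E) 1).tendsto_subseq
    (x := fun n => ‖a n‖⁻¹ • a n) fun n => by
      simp [norm_smul, (hpos n).ne']
  refine ⟨w, fun h => by simp [h] at hw, fun t => ?_⟩
  -- Rounding `t / ‖a‖` down to an integer changes the multiple of `a` by at most `‖a‖`, which tends
  -- to `0`.
  have h0 : Tendsto (fun n => ⌊t / ‖a (φ n)‖⌋ • a (φ n)) atTop (𝓝 (t • w)) := by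
    have h1 : Tendsto (fun n => t • (‖a (φ n)‖⁻¹ • a (φ n)) -
        Int.fract (t / ‖a (φ n)‖) • a (φ n)) atTop (𝓝 (t • w - 0)) := by
      refine (hφw.const_smul t).sub (squeeze_zero_norm (fun n => ?_)
        (hlim.comp hφ.tendsto_atTop))
      rw [norm_smul, Real.norm_of_nonneg (Int.fract_nonneg _)]
      exact mul_le_of_le_one_left (norm_nonneg _) (Int.fract_lt_one _).le
    rw [sub_zero] at h1
    refine h1.congr fun n => ?_
    rw [smul_smul, ← sub_smul, ← div_eq_mul_inv, Int.self_sub_fract, Int.cast_smul_eq_zsmul]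
  exact hc.mem_of_tendsto h0 (.of_forall fun n => S.zsmul_mem (haS _) _)

/-- A lattice is cocompact. -/
theorem IsLattice.exists_norm_add_le {E : Type*} [NormedAddCommGroup E] [NormedSpace ℝ E]
    [FiniteDimensional ℝ E] {Λ : AddSubgroup E} (hΛ : IsLattice Λ) :
    ∃ R : ℝ, ∀ z : E, ∃ a ∈ Λ, ‖z + a‖ ≤ R := by
  have hd : DiscreteTopology (AddSubgroup.toIntSubmodule Λ) := hΛ.1
  have hz : IsZLattice ℝ (AddSubgroup.toIntSubmodule Λ) := ⟨hΛ.span_eq_top⟩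
  let b := (Module.Free.chooseBasis ℤ (AddSubgroup.toIntSubmodule Λ)).ofZLatticeBasis ℝ
  refine ⟨∑ i, ‖b i‖, fun z => ⟨-(ZSpan.floor b z : E), ?_, ?_⟩⟩
  · have h : (ZSpan.floor b z : E) ∈ Submodule.span ℤ (range b) := (ZSpan.floor b z).2
    exact Λ.neg_mem ((Module.Basis.ofZLatticeBasis_span ℝ _ _).le h)
  · rw [← sub_eq_add_neg, ← ZSpan.fract_apply]
    exact ZSpan.norm_fract_le b z

/-! ## Fields of abelian functions -/

theorem exists_common_denominator {n : ℕ} (f : Fin 2 → Mero n) :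
    ∃ (G : Fin 2 → Entire n) (H : Entire n), H ≠ 0 ∧ ∀ i, f i = (G i).toMero / H.toMero := by
  obtain ⟨⟨H, hH⟩, hf⟩ := IsLocalization.exist_integer_multiples_of_finite
    (nonZeroDivisors (Entire n)) f
  choose G hG using hf
  have hH0 : H ≠ 0 := nonZeroDivisors.ne_zero hH
  refine ⟨G, H, hH0, fun i => ?_⟩
  rw [eq_div_iff (Entire.toMero_ne_zero hH0), mul_comm]
  exact (Algebra.smul_def H (f i)).symm.trans (hG i).symm

/-- For each index and base point, the cross-multiplied identity is a closed condition on the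
translation. -/
theorem isClosed_periods {n : ℕ} {ι : Type*} (f : ι → Mero n) :
    IsClosed (periods f : Set (Fin n → ℂ)) := by
  choose g h hh hf using fun i => IsFractionRing.div_surjective (A := Entire n) (f i)
  obtain rfl : (fun i => (g i).toMero / (h i).toMero) = f := funext hf
  have e : (periods (fun i => (g i).toMero / (h i).toMero) : Set (Fin n → ℂ)) =
      ⋂ (i) (b), {a | g i b * h i (b + a) = h i b * g i (b + a)} := by
    ext a
    simpa using! mem_periods_div_iff g h (fun i => nonZeroDivisors.ne_zero (hh i)) a
  have hc : ∀ k : Entire n, Continuous k := fun k => continuousOn_univ.mp k.analytic.continuousOn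
  rw [e]
  exact isClosed_iInter fun i => isClosed_iInter fun b => isClosed_eq
    (continuous_const.mul ((hc _).comp (continuous_const_add b)))
    (continuous_const.mul ((hc _).comp (continuous_const_add b)))

theorem Entire.differentiable_line {n : ℕ} (f : Entire n) (b w : Fin n → ℂ) :
    Differentiable ℂ fun t : ℂ => f (b + t • w) := fun t =>
  (f.analytic (b + t • w) (mem_univ _)).differentiableAt.comp t (f := fun t : ℂ => b + t • w)
    (by fun_prop)

/-- If the real multiples of `w` are periods, then so are the complex ones. -/
theorem smul_mem_periods_of_real {n : ℕ} {ι : Type*} {f : ι → Mero n} {w : Fin n → ℂ}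
    (hw : ∀ t : ℝ, t • w ∈ periods f) (t : ℂ) : t • w ∈ periods f := by
  choose g h hh hf using fun i => IsFractionRing.div_surjective (A := Entire n) (f i)
  obtain rfl : (fun i => (g i).toMero / (h i).toMero) = f := funext hf
  have key := mem_periods_div_iff g h fun i => nonZeroDivisors.ne_zero (hh i)
  refine (key _).mpr fun i b => ?_
  let φ : ℂ → ℂ := fun t => g i b * h i (b + t • w) - h i b * g i (b + t • w)
  have hφ : Differentiable ℂ φ :=
    (((h i).differentiable_line b w).const_mul _).sub (((g i).differentiable_line b w).const_mul _)
  have h0 : ∀ x : ℝ, φ x = 0 := fun x => by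
    have := (key _).mp (hw x) i b
    rw [← Complex.coe_smul] at this
    exact sub_eq_zero.mpr this
  have hfreq : ∃ᶠ z in 𝓝[≠] (0 : ℂ), φ z = 0 := by
    have ht : Tendsto (fun x : ℝ => (x : ℂ)) (𝓝[≠] 0) (𝓝[≠] 0) :=
      tendsto_nhdsWithin_iff.mpr ⟨(Complex.continuous_ofReal.tendsto' 0 0 rfl).mono_left
        nhdsWithin_le_nhds, by
          filter_upwards [self_mem_nhdsWithin] with x hx
          simpa using hx⟩
    exact ht.frequently (Eventually.of_forall h0).frequently
  have := AnalyticOnNhd.eqOn_zero_of_preconnected_of_frequently_eq_zero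
    (fun z _ => hφ.analyticAt z) isPreconnected_univ (mem_univ 0) hfreq (mem_univ t)
  exact sub_eq_zero.mp this

/-- The form `l` is `det (w, z)`, which vanishes exactly on `ℂ w`; it serves to project along `w`.
-/
theorem exists_complement {w : Fin 2 → ℂ} (hw : w ≠ 0) :
    ∃ (l : (Fin 2 → ℂ) →L[ℂ] ℂ) (w' : Fin 2 → ℂ), l w' = 1 ∧
      ∀ z, ∃ s : ℂ, z = l z • w' + s • w := by
  refine ⟨w 0 • ContinuousLinearMap.proj 1 - w 1 • ContinuousLinearMap.proj 0, ?_⟩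
  by_cases h0 : w 0 = 0
  · have h1 : w 1 ≠ 0 := fun h1 => hw (funext fun i => by fin_cases i <;> assumption)
    refine ⟨![-1 / w 1, 0], ?_, fun z => ⟨z 1 / w 1, ?_⟩⟩
    · simp [h0]
      field_simp
    · ext i
      fin_cases i <;> simp [h0] <;> field_simp
  · refine ⟨![0, 1 / w 0], ?_, fun z => ⟨z 0 / w 0, ?_⟩⟩
    · simp [h0]
    · ext i
      fin_cases i <;> simp <;> field_simp
      ring

theorem Entire.sum_apply {n : ℕ} {ι : Type*} (s : Finset ι) (f : ι → Entire n) (z : Fin n → ℂ) :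
    (∑ i ∈ s, f i) z = ∑ i ∈ s, f i z := by
  classical
  induction s using Finset.induction_on with
  | empty => simp
  | insert i s hi ih => rw [Finset.sum_insert hi, Finset.sum_insert hi, Entire.add_apply, ih]

theorem homMonomial_apply {n N : ℕ} (p : Fin (N + 1) × Fin (N + 1)) (G : Fin 2 → Entire n)
    (H : Entire n) (z : Fin n → ℂ) :
    homMonomial p G H z = homMonomial p (fun i => G i z) (H z) := by
  simp [homMonomial]

/-- Functions on `ℂ²` with a cocompact group of periods that contains a complex line are
algebraically dependent. -/
theorem exists_relation_of_line {G : Fin 2 → Entire 2} {H : Entire 2} (hH : H ≠ 0)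
    {w : Fin 2 → ℂ} (hw : w ≠ 0)
    (hline : ∀ t : ℂ, t • w ∈ periods fun i => (G i).toMero / H.toMero) {R : ℝ}
    (hR : ∀ z, ∃ a ∈ periods fun i => (G i).toMero / H.toMero, ‖z + a‖ ≤ R) :
    ∃ (N : ℕ) (c : Fin (N + 1) × Fin (N + 1) → ℂ), c ≠ 0 ∧
      ∑ p, c p • homMonomial p G H = 0 := by
  set S := periods fun i => (G i).toMero / H.toMero
  have key : ∀ a, a ∈ S ↔ ∀ i, ∀ b : Fin 2 → ℂ, G i b * H (b + a) = H b * G i (b + a) :=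
    mem_periods_div_iff G (fun _ => H) fun _ => hH
  obtain ⟨z₀, hz₀⟩ : ∃ z, H z ≠ 0 := by
    by_contra! h
    exact hH (DFunLike.ext _ _ fun z => by simpa using h z)
  obtain ⟨l, w', hlw', hl⟩ := exists_complement hw
  -- Restriction to `z₀ + ℂ w'`: modulo the periods `ℂ w`, a period `a` becomes `l a • w'`, so the
  -- periods on this line stay cocompact.
  obtain ⟨N, c, hc, hrel⟩ := exists_algebraic_relation
    (G := fun i t => G i (z₀ + t • w')) (H := fun t => H (z₀ + t • w'))
    (H.differentiable_line z₀ w') (fun i => (G i).differentiable_line z₀ w') (z₁ := 0)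
    (by simpa using hz₀) (Γ := {γ | γ • w' ∈ S}) (R := ‖l‖ * R)
    (fun z => by
      obtain ⟨a, ha, hza⟩ := hR (z • w')
      refine ⟨l a, ?_, ?_⟩
      · obtain ⟨s, hs⟩ := hl a
        have : l a • w' = a - s • w := eq_sub_of_add_eq hs.symm
        change l a • w' ∈ S
        rw [this]
        exact S.sub_mem ha (hline s)
      · have : z + l a = l (z • w' + a) := by simp [hlw']
        rw [this]
        exact (l.le_opNorm _).trans (by gcongr))
    (fun γ hγ i t => by
      have := (key _).mp hγ i (z₀ + t • w')
      rw [add_assoc, ← add_smul] at this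
      rw [this, mul_comm])
  refine ⟨N, c, hc, ?_⟩
  -- Projection along `w` onto that line. As `z` and `ψ z` differ by a period, the relation
  -- transfers from `ψ z` to `z` wherever `H (ψ z) ≠ 0`.
  let ψ : (Fin 2 → ℂ) → Fin 2 → ℂ := fun z => z₀ + l (z - z₀) • w'
  have hψ : AnalyticOnNhd ℂ ψ univ := fun z _ =>
    analyticAt_const.add (((l.analyticAt _).comp (analyticAt_id.sub analyticAt_const)).smul
      analyticAt_const)
  have hK : Entire.comp ψ hψ H ≠ 0 := fun h => by
    have := DFunLike.congr_fun h z₀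
    simp [ψ] at this
    exact hz₀ this
  refine Entire.eq_zero_of_mul hK fun z hz => ?_
  obtain ⟨s, hs⟩ := hl (z - z₀)
  have hzs : z = ψ z + s • w := by
    rw [add_assoc, ← hs, add_sub_cancel]
  have hG : ∀ i, G i z * H (ψ z) = G i (ψ z) * H z := fun i => by
    have := (key _).mp (hline s) i (ψ z)
    rw [← hzs] at this
    rw [this, mul_comm]
  have h1 := hrel (l (z - z₀))
  rw [Entire.sum_apply]
  have h2 : (∑ p, (c p • homMonomial p G H) z) * H (ψ z) ^ (2 * N) =
      (∑ p, c p * homMonomial p (fun i => G i (ψ z)) (H (ψ z))) * H z ^ (2 * N) := by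
    rw [Finset.sum_mul, Finset.sum_mul]
    refine Finset.sum_congr rfl fun p _ => ?_
    rw [Entire.smul_apply, homMonomial_apply, mul_assoc, homMonomial_mul_pow p hG, mul_assoc]
  rw [h1, zero_mul] at h2
  exact (mul_eq_zero.mp h2).resolve_right (pow_ne_zero _ hz)

/-- With `h = 1` the homogenised monomials are ordinary ones with distinct exponents, so `c` is the
coefficient family of a nonzero polynomial. -/
theorem not_algebraicIndependent_of_relation {K A : Type*} [Field K] [CommRing A] [Algebra K A]
    {f : Fin 2 → A} {N : ℕ} {c : Fin (N + 1) × Fin (N + 1) → K} (hc : c ≠ 0)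
    (h : ∑ p, c p • homMonomial p f 1 = 0) : ¬AlgebraicIndependent K f := by
  intro hf
  let e : Fin (N + 1) × Fin (N + 1) → Fin 2 →₀ ℕ := fun p =>
    Finsupp.equivFunOnFinite.symm ![p.1, p.2]
  have he : Function.Injective e := fun p q hpq => by
    have := Finsupp.equivFunOnFinite.symm.injective hpq
    have h0 := congrFun this 0
    have h1 := congrFun this 1
    exact Prod.ext (Fin.ext h0) (Fin.ext h1)
  let P : MvPolynomial (Fin 2) K := ∑ p, MvPolynomial.monomial (e p) (c p)
  have hP : MvPolynomial.aeval f P = 0 := by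
    rw [map_sum, ← h]
    refine Finset.sum_congr rfl fun p _ => ?_
    rw [MvPolynomial.aeval_monomial, Algebra.smul_def, Finsupp.prod_fintype _ _ (by simp)]
    simp [homMonomial, e]
  have hP0 : P = 0 := hf.eq_zero_of_aeval_eq_zero P hP
  refine hc (funext fun q => ?_)
  have := congrArg (MvPolynomial.coeff (e q)) hP0
  rw [MvPolynomial.coeff_sum] at this
  simpa [MvPolynomial.coeff_monomial, he.eq_iff] using this

/-- Algebraically independent abelian functions have a discrete group of periods. -/
theorem discreteTopology_periods_of_algebraicIndependent {Λ : AddSubgroup (Fin 2 → ℂ)}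
    (hΛ : IsLattice Λ) {f : Fin 2 → abelianFunctions Λ} (hf : AlgebraicIndependent ℂ f) :
    DiscreteTopology (periods fun i => (f i : Mero 2)) := by
  by_contra hd
  obtain ⟨w, hw, hline⟩ := exists_line_of_not_discreteTopology (isClosed_periods _) hd
  have hline' := smul_mem_periods_of_real hline
  obtain ⟨G, H, hH, hGH⟩ := exists_common_denominator fun i => (f i : Mero 2)
  obtain ⟨R, hR⟩ := hΛ.exists_norm_add_le
  have hR' : ∀ z, ∃ a ∈ periods fun i => (f i : Mero 2), ‖z + a‖ ≤ R := fun z => by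
    obtain ⟨a, ha, h⟩ := hR z
    exact ⟨a, fun i => (f i).2 ha (), h⟩
  have hfe : (fun i => (f i : Mero 2)) = fun i => (G i).toMero / H.toMero := funext hGH
  rw [hfe] at hline' hR'
  obtain ⟨N, c, hc, hrel⟩ := exists_relation_of_line hH hw hline' hR'
  refine not_algebraicIndependent_of_relation hc ?_ hf
  have hH' := Entire.toMero_ne_zero hH
  -- Dividing by `H ^ (2 * N)` turns the relation between entire functions into one between the `f
  -- i`.
  have hmon : ∀ p : Fin (N + 1) × Fin (N + 1), (homMonomial p G H).toMero =
      (homMonomial p f 1 : abelianFunctions Λ) * H.toMero ^ (2 * N) := fun p => by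
    have h1 := map_homMonomial (algebraMap (Entire 2) (Mero 2)) p G H
    have h2 := map_homMonomial (algebraMap (abelianFunctions Λ) (Mero 2)) p f 1
    have h3 := homMonomial_mul_pow p (x := fun i => (G i).toMero) (h := H.toMero)
      (x' := fun i => (f i : Mero 2)) (h' := 1) fun i => by
        rw [hGH i, mul_one, div_mul_cancel₀ _ hH']
    rw [map_one] at h2
    rw [one_pow, mul_one] at h3
    exact h1.trans (h3.trans (congrArg (· * H.toMero ^ (2 * N)) h2.symm))
  have h := congrArg (algebraMap (Entire 2) (Mero 2)) hrel
  rw [map_sum, map_zero] at h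
  have h' : ((∑ p, c p • homMonomial p f 1 : abelianFunctions Λ) : Mero 2) *
      H.toMero ^ (2 * N) = 0 := by
    rw [← h, IntermediateField.coe_sum, Finset.sum_mul]
    refine Finset.sum_congr rfl fun p _ => ?_
    rw [IntermediateField.coe_smul, smul_mul_assoc, ← hmon p]
    exact (map_smul (IsScalarTower.toAlgHom ℂ (Entire 2) (Mero 2)) _ _).symm
  exact Subtype.ext ((mul_eq_zero.mp h').resolve_right (pow_ne_zero _ hH'))

theorem exists_isTranscendenceBasis_fin {K A : Type} [Field K] [Field A] [Algebra K A] {n : ℕ}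
    (h : Algebra.trdeg K A = n) : ∃ f : Fin n → A, IsTranscendenceBasis K f := by
  obtain ⟨s, hs⟩ := exists_isTranscendenceBasis K A
  have hc : Cardinal.mk s = n := hs.cardinalMk_eq_trdeg.trans h
  obtain ⟨e⟩ := Cardinal.mk_eq_nat_iff.mp hc
  exact ⟨_, (isTranscendenceBasis_equiv e.symm).mpr hs⟩

/-- The period group of a basis is discrete and contains `Λ`, hence spans `ℂ²` over `ℝ` and has rank
`4`, even if it is larger than `Λ`. -/
theorem familyHasZRank_P6 : FamilyHasZRank P6 4 := by
  rintro _ ⟨Λ, hΛ, hdeg, rfl⟩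
  obtain ⟨f, hf⟩ := exists_isTranscendenceBasis_fin (n := 2) (by exact_mod_cast hdeg)
  have hd := discreteTopology_periods_of_algebraicIndependent hΛ hf.1
  refine hasZRank_of_isTranscendenceBasis hf hd ?_
  set S := periods fun i => (f i : Mero 2)
  have hle : Λ ≤ S := fun a ha i => (f i).2 ha ()
  have hdS : DiscreteTopology (AddSubgroup.toIntSubmodule S) := hd
  have hz : IsZLattice ℝ (AddSubgroup.toIntSubmodule S) :=
    ⟨top_le_iff.mp (hΛ.span_eq_top.ge.trans (Submodule.span_mono hle))⟩
  have h := ZLattice.rank ℝ (AddSubgroup.toIntSubmodule S)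
  rw [Module.finrank_pi_fintype] at h
  simpa [Complex.finrank_real_complex] using! h

end Painleve

end

theorem proposition5p4 :
    Painleve.FamilyHasZRank Painleve.P1 0 ∧
    Painleve.FamilyHasZRank Painleve.P2 1 ∧
    Painleve.FamilyHasZRank Painleve.P3 2 ∧
    Painleve.FamilyHasZRank Painleve.P4 2 ∧
    Painleve.FamilyHasZRank Painleve.P5 3 ∧
    Painleve.FamilyHasZRank Painleve.P6 4 :=
  ⟨Painleve.familyHasZRank_P1, Painleve.familyHasZRank_P2, Painleve.familyHasZRank_P3,
    Painleve.familyHasZRank_P4, Painleve.familyHasZRank_P5, Painleve.familyHasZRank_P6⟩
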